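/- Let $\mathbb T^3$ be the three-dimensional torus, identified as a set with the cube $(-\pi,\pi]^3$ and equipped with its Haar measure. For $k,p\in\mathbb T^3$ (represented in this cube) and $\gamma\in\mathbb R$ put $$\varepsilon(q)=\sum_{i=1}^3(1-\cos q_i),\quad w_1(k)=\varepsilon(k)+\gamma,\quad w_2(k,p)=\varepsilon(k)+\varepsilon\big(\tfrac12(k+p)\big)+\varepsilon(p),$$ where $\tfrac12(k+p)$ is computed with the representatives in $(-\pi,\pi]^3$. Let $\mathcal H_1=L_2(\mathbb T^3)$ and let $\mathcal H_2\subset L_2((\mathbb T^3)^2)$ be the subspace of symmetric functions. For $\mu>0$ let $\mathcal A_\mu$ be the bounded self-adjoint operator $$\mathcal A_\mu=\begin{pmatrix}A_{11}&\mu A_{12}\\ \mu A_{12}^*&A_{22}\end{pmatrix}\quad\text{in }\mathcal H_1\oplus\mathcal H_2,$$ $(A_{11}f_1)(k)=w_1(k)f_1(k)$, $(A_{12}f_2)(k)=\int_{\mathbb T^3}f_2(k,s)\,ds$, $(A_{22}f_2)(k,p)=w_2(k,p)f_2(k,p)$. For $k\in\mathbb T^3$ let $$\mathcal A_\mu(k)=\begin{pmatrix}w_1(k)&\frac{\mu}{\sqrt2}A_{01}\\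 \frac{\mu}{\sqrt2}A_{01}^*&w_2(k,\cdot)\end{pmatrix}\quad\text{in }\mathbb C\oplus L_2(\mathbb T^3),\qquad A_{01}f=\int_{\mathbb T^3}f(t)\,dt,$$ where $w_2(k,\cdot)$ acts by multiplication. For a bounded self-adjoint operator, $\sigma_{\rm disc}$ denotes the set of isolated points of the spectrum that are eigenvalues of finite multiplicity, and $\sigma_{\rm ess}=\sigma\setminus\sigma_{\rm disc}$. Put $\Lambda_\mu=\bigcup_{k\in\mathbb T^3}\sigma_{\rm disc}(\mathcal A_\mu(k))$ and $$I(k;0)=\int_{\mathbb T^3}\frac{dt}{w_2(k,t)},\qquad \Delta_\mu(k;0)=w_1(k)-\frac{\mu^2}{2}I(k;0).$$ Let $\gamma<12$ and $\mu=\mu_r^0(\gamma):=\sqrt{24-2\gamma}\;I(\overline 0;0)^{-1/2}$. Then the integrals $I(k;0)$, $k\in\mathbb T^3$, converge, $\Delta_\mu(\cdot\,;0)$ attains its maximum on $\mathbb T^3$, and for every point $k_0$ at which it is attained, with $$\gamma_0:=\Big(12\,\frac{I(k_0;0)}{I(\overline 0;0)}-\varepsilon(k_0)\Big)\Big(1+\frac{I(k_0;0)}{I(\overline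 0;0)}\Big)^{-1},$$ one has $$\sigma_{\rm ess}(\mathcal A_\mu)=\begin{cases}[E_1,E_2]\cup[0,18],&\gamma<\gamma_0,\\ [E_1,18],&\gamma_0\le\gamma<6,\\ [0,18],&6\le\gamma<12,\end{cases}$$ where $E_1=\min\{\Lambda_\mu\cap(-\infty,0]\}$ (in the first two cases) and $E_2=\max\{\Lambda_\mu\cap(-\infty,0]\}$ (in the first case), these extrema being attained. -/

import Mathlib

open MeasureTheory Set Filter Topology
open scoped ENNReal Real

noncomputable section

namespace FockLattice

/-! ### Spectra of bounded operators -/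

section Spectra

variable {H : Type*} [NormedAddCommGroup H] [InnerProductSpace ℂ H]

/-- The discrete spectrum of a bounded (self-adjoint) operator: the isolated points of the spectrum
that are eigenvalues of finite multiplicity. -/
def discreteSpectrum (A : H →L[ℂ] H) : Set ℂ :=
  {z | z ∈ spectrum ℂ A ∧ (∃ U ∈ 𝓝 z, U ∩ spectrum ℂ A = {z}) ∧
    Module.End.HasEigenvalue (A : H →ₗ[ℂ] H) z ∧
    FiniteDimensional ℂ (Module.End.eigenspace (A : H →ₗ[ℂ] H) z)}

/-- The essential spectrum of a bounded self-adjoint operator: the complement of the discrete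
spectrum in the spectrum. -/
def essentialSpectrum (A : H →L[ℂ] H) : Set ℂ :=
  spectrum ℂ A \ discreteSpectrum A

end Spectra

/-! ### Building blocks: block, multiplication and integral operators -/

section Blocks

variable {E F : Type*} [NormedAddCommGroup E] [InnerProductSpace ℂ E]
  [NormedAddCommGroup F] [InnerProductSpace ℂ F]

/-- The operator `(x, y) ↦ (A x + B y, C x + D y)` in the Hilbert direct sum `E ⊕ F`. -/
def blockOp (A : E →L[ℂ] E) (B : F →L[ℂ] E) (C : E →L[ℂ] F) (D : F →L[ℂ] F) :
    WithLp 2 (E × F) →L[ℂ] WithLp 2 (E × F) :=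
  ((WithLp.prodContinuousLinearEquiv 2 ℂ E F).symm : E × F →L[ℂ] WithLp 2 (E × F)) ∘L
    ((A.coprod B).prod (C.coprod D)) ∘L
      ((WithLp.prodContinuousLinearEquiv 2 ℂ E F) : WithLp 2 (E × F) →L[ℂ] E × F)

lemma blockOp_apply (A : E →L[ℂ] E) (B : F →L[ℂ] E) (C : E →L[ℂ] F) (D : F →L[ℂ] F)
    (x : E) (y : F) :
    blockOp A B C D (WithLp.toLp 2 (x, y)) = WithLp.toLp 2 (A x + B y, C x + D y) := rfl

end Blocks

section Operators

variable {X : Type*} [MeasurableSpace X] {ν : Measure X}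

/-- The operator of multiplication by an essentially bounded function `w` in `L₂`. -/
def mulOp (w : X → ℂ) (hw : MemLp w ∞ ν) : Lp ℂ 2 ν →L[ℂ] Lp ℂ 2 ν :=
  (ContinuousLinearMap.mul ℂ ℂ).holderL ν ∞ 2 2 (hw.toLp w)

lemma mulOp_apply (w : X → ℂ) (hw : MemLp w ∞ ν) (f : Lp ℂ 2 ν) :
    mulOp w hw f =ᵐ[ν] fun x => w x * f x := by
  have h := (ContinuousLinearMap.mul ℂ ℂ).coeFn_holder (r := 2) (hw.toLp w) f
  filter_upwards [h, hw.coeFn_toLp] with x hx hx'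
  simpa [mulOp, hx'] using hx

/-- The functional `f ↦ ∫ f(t) dt` on `L₂` of a finite measure. -/
def integralFunctional (ν : Measure X) [IsFiniteMeasure ν] : Lp ℂ 2 ν →L[ℂ] ℂ :=
  (ContinuousLinearMap.mul ℂ ℂ).lpPairing ν 2 2 (Lp.const 2 ν (1 : ℂ))

lemma integralFunctional_apply [IsFiniteMeasure ν] (f : Lp ℂ 2 ν) :
    integralFunctional ν f = ∫ t, f t ∂ν := by
  rw [integralFunctional, ContinuousLinearMap.lpPairing_eq_integral]
  refine integral_congr_ae ?_
  filter_upwards [Lp.coeFn_const (p := 2) (μ := ν) (1 : ℂ)] with x hx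
  rw [hx, Function.const_apply, ContinuousLinearMap.mul_apply', one_mul]

lemma eLpNorm_integral_section_le [IsFiniteMeasure ν] {f : X × X → ℂ}
    (hf : AEStronglyMeasurable f (ν.prod ν)) :
    eLpNorm (fun k => ∫ s, f (k, s) ∂ν) 2 ν ≤
      (ν univ) ^ (1 / 2 : ℝ) * eLpNorm f 2 (ν.prod ν) := by
  have key : ∀ᵐ k ∂ν, ‖∫ s, f (k, s) ∂ν‖ₑ ^ (2 : ℝ) ≤
      ν univ * ∫⁻ s, ‖f (k, s)‖ₑ ^ (2 : ℝ) ∂ν := by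
    filter_upwards [hf.prodMk_left] with k hk
    have h1 : ‖∫ s, f (k, s) ∂ν‖ₑ ≤ eLpNorm (fun s => f (k, s)) 1 ν := by
      rw [eLpNorm_one_eq_lintegral_enorm]
      exact enorm_integral_le_lintegral_enorm _
    have h2 := eLpNorm_le_eLpNorm_mul_rpow_measure_univ (p := 1) (q := 2) (by norm_num) hk
    have h3 := ENNReal.rpow_le_rpow (h1.trans h2) (by norm_num : (0 : ℝ) ≤ 2)
    refine h3.trans (le_of_eq ?_)
    rw [ENNReal.mul_rpow_of_nonneg _ _ (by norm_num), ← ENNReal.rpow_mul,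
      eLpNorm_eq_lintegral_rpow_enorm_toReal (by norm_num) (by norm_num), ← ENNReal.rpow_mul]
    norm_num
    rw [mul_comm]
  rw [eLpNorm_eq_lintegral_rpow_enorm_toReal (by norm_num) (by norm_num),
    eLpNorm_eq_lintegral_rpow_enorm_toReal (by norm_num) (by norm_num)]
  simp only [ENNReal.toReal_ofNat]
  rw [← ENNReal.mul_rpow_of_nonneg _ _ (by norm_num)]
  refine ENNReal.rpow_le_rpow ?_ (by norm_num)
  have hm : AEMeasurable (fun x => ‖f x‖ₑ ^ (2 : ℝ)) (ν.prod ν) := hf.enorm.pow_const _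
  rw [lintegral_prod _ hm]
  refine (lintegral_mono_ae key).trans (le_of_eq ?_)
  exact lintegral_const_mul'' _ hm.lintegral_prod_right'

lemma memLp_integral_section [IsFiniteMeasure ν] (f : Lp ℂ 2 (ν.prod ν)) :
    MemLp (fun k => ∫ s, f (k, s) ∂ν) 2 ν := by
  refine ⟨(Lp.aestronglyMeasurable f).integral_prod_right', ?_⟩
  refine (eLpNorm_integral_section_le (Lp.aestronglyMeasurable f)).trans_lt ?_
  exact ENNReal.mul_lt_top (ENNReal.rpow_lt_top_of_nonneg (by norm_num) (measure_ne_top _ _))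
    (Lp.eLpNorm_lt_top f)

lemma integrable_section [IsFiniteMeasure ν] (f : Lp ℂ 2 (ν.prod ν)) :
    ∀ᵐ k ∂ν, Integrable (fun s => f (k, s)) ν :=
  ((Lp.memLp f).integrable (by norm_num)).prod_right_ae

/-- The operator `f ↦ (k ↦ ∫ f(k, s) ds)` from `L₂(X × X)` to `L₂(X)`. -/
def integrateSnd (ν : Measure X) [IsFiniteMeasure ν] :
    Lp ℂ 2 (ν.prod ν) →L[ℂ] Lp ℂ 2 ν :=
  LinearMap.mkContinuous
    { toFun := fun f => (memLp_integral_section f).toLp _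
      map_add' := fun f g => by
        rw [← MemLp.toLp_add]
        refine MemLp.toLp_congr _ _ ?_
        filter_upwards [Measure.ae_ae_of_ae_prod (Lp.coeFn_add f g), integrable_section f,
          integrable_section g] with k hk hf hg
        rw [Pi.add_apply, ← integral_add hf hg]
        exact integral_congr_ae hk
      map_smul' := fun c f => by
        rw [RingHom.id_apply, ← MemLp.toLp_const_smul]
        refine MemLp.toLp_congr _ _ ?_
        filter_upwards [Measure.ae_ae_of_ae_prod (Lp.coeFn_smul c f)] with k hk
        rw [Pi.smul_apply, ← integral_smul]
        exact integral_congr_ae hk }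
    ((ν univ) ^ (1 / 2 : ℝ)).toReal
    (fun f => by
      simp only [LinearMap.coe_mk, AddHom.coe_mk]
      rw [Lp.norm_toLp, Lp.norm_def, ← ENNReal.toReal_mul]
      exact ENNReal.toReal_mono
        (ENNReal.mul_ne_top (ENNReal.rpow_ne_top_of_nonneg (by norm_num) (measure_ne_top _ _))
          (Lp.eLpNorm_ne_top f))
        (eLpNorm_integral_section_le (Lp.aestronglyMeasurable f)))

lemma integrateSnd_apply [IsFiniteMeasure ν] (f : Lp ℂ 2 (ν.prod ν)) :
    integrateSnd ν f =ᵐ[ν] fun k => ∫ s, f (k, s) ∂ν :=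
  (memLp_integral_section f).coeFn_toLp

/-- The closed subspace of symmetric functions in `L₂(X × X)`. -/
def symL2 (ν : Measure X) [IsFiniteMeasure ν] : Submodule ℂ (Lp ℂ 2 (ν.prod ν)) where
  carrier := {f | ∀ᵐ x ∂(ν.prod ν), f x.swap = f x}
  add_mem' := by
    intro f g hf hg
    have h := Lp.coeFn_add f g
    have h' := (Measure.measurePreserving_swap (μ := ν) (ν := ν)).quasiMeasurePreserving.ae h
    filter_upwards [hf, hg, h, h'] with x h1 h2 h3 h4
    rw [h3, h4, Pi.add_apply, Pi.add_apply, h1, h2]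
  zero_mem' := by
    have h := Lp.coeFn_zero ℂ 2 (ν.prod ν)
    have h' := (Measure.measurePreserving_swap (μ := ν) (ν := ν)).quasiMeasurePreserving.ae h
    filter_upwards [h, h'] with x h3 h4
    rw [h3, h4, Pi.zero_apply, Pi.zero_apply]
  smul_mem' := by
    intro c f hf
    have h := Lp.coeFn_smul c f
    have h' := (Measure.measurePreserving_swap (μ := ν) (ν := ν)).quasiMeasurePreserving.ae h
    filter_upwards [hf, h, h'] with x h1 h3 h4
    rw [h3, h4, Pi.smul_apply, Pi.smul_apply, h1]

lemma mem_symL2 [IsFiniteMeasure ν] {f : Lp ℂ 2 (ν.prod ν)} :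
    f ∈ symL2 ν ↔ ∀ᵐ x ∂(ν.prod ν), f x.swap = f x := Iff.rfl

lemma isClosed_symL2 (ν : Measure X) [IsFiniteMeasure ν] :
    IsClosed (symL2 ν : Set (Lp ℂ 2 (ν.prod ν))) := by
  have hs := Measure.measurePreserving_swap (μ := ν) (ν := ν)
  have : (symL2 ν : Set (Lp ℂ 2 (ν.prod ν))) =
      {f | Lp.compMeasurePreservingₗᵢ ℂ Prod.swap hs f = f} := by
    ext f
    have h := Lp.coeFn_compMeasurePreserving f hs
    constructor
    · intro hf
      refine Lp.ext ?_
      filter_upwards [h, mem_symL2.1 hf] with x h1 h2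
      exact h1.trans h2
    · intro hf
      refine mem_symL2.2 ?_
      have hf' : Lp.compMeasurePreserving Prod.swap hs f = f := hf
      rw [hf'] at h
      filter_upwards [h] with x h1
      exact h1.symm
  rw [this]
  exact isClosed_eq (LinearIsometry.continuous _) continuous_id

instance instCompleteSymL2 (ν : Measure X) [IsFiniteMeasure ν] : CompleteSpace (symL2 ν) :=
  (isClosed_symL2 ν).completeSpace_coe

lemma mulOp_mem_symL2 [IsFiniteMeasure ν] (w : X × X → ℂ) (hw : MemLp w ∞ (ν.prod ν))
    (hsym : ∀ x, w x.swap = w x) (f : Lp ℂ 2 (ν.prod ν)) (hf : f ∈ symL2 ν) :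
    mulOp w hw f ∈ symL2 ν := by
  have h := mulOp_apply w hw f
  have h' := (Measure.measurePreserving_swap (μ := ν) (ν := ν)).quasiMeasurePreserving.ae h
  refine mem_symL2.2 ?_
  filter_upwards [mem_symL2.1 hf, h, h'] with x h1 h3 h4
  rw [h3, h4, h1, hsym]

/-- Multiplication by a bounded symmetric function in the space of symmetric functions. -/
def symMulOp [IsFiniteMeasure ν] (w : X × X → ℂ) (hw : MemLp w ∞ (ν.prod ν))
    (hsym : ∀ x, w x.swap = w x) : symL2 ν →L[ℂ] symL2 ν :=
  (mulOp w hw ∘L (symL2 ν).subtypeL).codRestrict (symL2 ν)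
    (fun f => mulOp_mem_symL2 w hw hsym f f.2)

end Operators

/-! ### The lattice model -/

instance instTwoPiPos : Fact (0 < 2 * π) := ⟨Real.two_pi_pos⟩

/-- The three-dimensional torus; its volume is the Haar measure of total mass `(2π)³`. -/
abbrev T3 : Type := Fin 3 → AddCircle (2 * π)

/-- The representative of a point of the torus in the cube `(-π, π]³`. -/
def rep (k : T3) : Fin 3 → ℝ := fun i => (AddCircle.equivIoc (2 * π) (-π) (k i) : ℝ)

/-- The dispersion function `ε(q) = ∑ᵢ (1 - cos qᵢ)`. -/
def disp (q : Fin 3 → ℝ) : ℝ := ∑ i, (1 - Real.cos (q i))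

/-- `w₁(k) = ε(k) + γ`. -/
def w1 (γ : ℝ) (k : T3) : ℝ := disp (rep k) + γ

/-- `w₂(k, p) = ε(k) + ε((k + p)/2) + ε(p)`, where `(k + p)/2` is formed in the cube
`(-π, π]³`. -/
def w2 (k p : T3) : ℝ :=
  disp (rep k) + disp ((1 / 2 : ℝ) • (rep k + rep p)) + disp (rep p)

lemma measurable_rep : Measurable rep := by
  refine measurable_pi_lambda _ fun i => ?_
  exact measurable_subtype_coe.comp
    ((AddCircle.measurableEquivIoc (2 * π) (-π)).measurable.comp (measurable_pi_apply i))

lemma continuous_disp : Continuous disp := by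
  unfold disp
  fun_prop

lemma abs_disp_le (q : Fin 3 → ℝ) : |disp q| ≤ 6 := by
  have h1 := fun i => Real.cos_le_one (q i)
  have h2 := fun i => Real.neg_one_le_cos (q i)
  rw [disp, Fin.sum_univ_three, abs_le]
  constructor <;> linarith [h1 0, h1 1, h1 2, h2 0, h2 1, h2 2]

lemma measurable_w1 (γ : ℝ) : Measurable (w1 γ) :=
  (continuous_disp.measurable.comp measurable_rep).add_const γ

lemma measurable_w2 : Measurable (fun x : T3 × T3 => w2 x.1 x.2) := by
  have h1 : Measurable fun x : T3 × T3 => rep x.1 := measurable_rep.comp measurable_fst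
  have h2 : Measurable fun x : T3 × T3 => rep x.2 := measurable_rep.comp measurable_snd
  exact ((continuous_disp.measurable.comp h1).add
    (continuous_disp.measurable.comp ((h1.add h2).const_smul (1 / 2 : ℝ)))).add
    (continuous_disp.measurable.comp h2)

lemma abs_w2_le (k p : T3) : |w2 k p| ≤ 18 := by
  have h1 := abs_le.1 (abs_disp_le (rep k))
  have h2 := abs_le.1 (abs_disp_le ((1 / 2 : ℝ) • (rep k + rep p)))
  have h3 := abs_le.1 (abs_disp_le (rep p))
  rw [w2, abs_le]
  constructor <;> linarith [h1.1, h1.2, h2.1, h2.2, h3.1, h3.2]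

lemma w2_comm (k p : T3) : w2 k p = w2 p k := by
  rw [w2, w2, add_comm (rep k) (rep p)]
  ring

lemma memLp_w1 (γ : ℝ) : MemLp (fun k : T3 => (w1 γ k : ℂ)) ∞ volume := by
  refine memLp_top_of_bound
    (Complex.measurable_ofReal.comp (measurable_w1 γ)).aestronglyMeasurable (6 + |γ|)
    (Eventually.of_forall fun k => ?_)
  rw [Complex.norm_real, Real.norm_eq_abs, w1]
  exact (abs_add_le _ _).trans (by linarith [abs_disp_le (rep k)])

lemma memLp_w2 :
    MemLp (fun x : T3 × T3 => (w2 x.1 x.2 : ℂ)) ∞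
      ((volume : Measure T3).prod (volume : Measure T3)) := by
  refine memLp_top_of_bound
    (Complex.measurable_ofReal.comp measurable_w2).aestronglyMeasurable 18
    (Eventually.of_forall fun x => ?_)
  rw [Complex.norm_real, Real.norm_eq_abs]
  exact abs_w2_le _ _

lemma memLp_w2_section (k : T3) : MemLp (fun p : T3 => (w2 k p : ℂ)) ∞ volume := by
  refine memLp_top_of_bound
    (Complex.measurable_ofReal.comp
      (measurable_w2.comp measurable_prodMk_left)).aestronglyMeasurable 18
    (Eventually.of_forall fun x => ?_)
  rw [Complex.norm_real, Real.norm_eq_abs]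
  exact abs_w2_le _ _

/-- The one-particle space `L₂(𝕋³)`. -/
abbrev H1 : Type := Lp ℂ 2 (volume : Measure T3)

/-- The two-particle space of symmetric functions in `L₂((𝕋³)²)`. -/
abbrev H2 : Type := symL2 (volume : Measure T3)

/-- The annihilation operator `(A₁₂ f)(k) = ∫ f(k, s) ds`. -/
def A12 : H2 →L[ℂ] H1 := integrateSnd (volume : Measure T3) ∘L (symL2 volume).subtypeL

/-- The operator matrix `𝒜_μ` (with parameter `γ` in `w₁`) in `H1 ⊕ H2`. -/
def opA (μ γ : ℝ) : WithLp 2 (H1 × H2) →L[ℂ] WithLp 2 (H1 × H2) :=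
  blockOp (mulOp (fun k => (w1 γ k : ℂ)) (memLp_w1 γ))
    ((μ : ℂ) • A12)
    ((μ : ℂ) • ContinuousLinearMap.adjoint A12)
    (symMulOp (fun x => (w2 x.1 x.2 : ℂ)) memLp_w2
      (fun x => congrArg Complex.ofReal (w2_comm x.2 x.1)))

/-- The generalized Friedrichs model `𝒜_μ(k)` in `ℂ ⊕ L₂(𝕋³)`. -/
def friedrichs (μ γ : ℝ) (k : T3) : WithLp 2 (ℂ × H1) →L[ℂ] WithLp 2 (ℂ × H1) :=
  blockOp ((w1 γ k : ℂ) • ContinuousLinearMap.id ℂ ℂ)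
    (((μ / √2 : ℝ) : ℂ) • integralFunctional (volume : Measure T3))
    (((μ / √2 : ℝ) : ℂ) • ContinuousLinearMap.adjoint (integralFunctional (volume : Measure T3)))
    (mulOp (fun p => (w2 k p : ℂ)) (memLp_w2_section k))

/-- `Λ_μ`, the union over `k` of the discrete spectra of the operators `𝒜_μ(k)`. -/
def Lam (μ γ : ℝ) : Set ℂ := ⋃ k : T3, discreteSpectrum (friedrichs μ γ k)

/-- `Λ_μ ∩ (-∞; 0]`, as a set of real numbers. -/
def LamNonpos (μ γ : ℝ) : Set ℝ := {x | (x : ℂ) ∈ Lam μ γ ∧ x ≤ 0}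

/-- `I(k; z) = ∫ dt / (w₂(k, t) - z)` for real `z`. -/
def intI (k : T3) (z : ℝ) : ℝ := ∫ t : T3, 1 / (w2 k t - z)

/-- `Δ_μ(k; z) = w₁(k) - z - (μ² / 2) I(k; z)` for real `z`. -/
def fredDet (μ γ : ℝ) (k : T3) (z : ℝ) : ℝ := w1 γ k - z - μ ^ 2 / 2 * intI k z

/-- `μ_r^0(γ) = √(24 - 2γ) · I(0; 0)^(-1/2)`. -/
def muR (γ : ℝ) : ℝ := √(24 - 2 * γ) / √(intI 0 0)

/-- The expression defining `γ₀` from a point `k₀`. -/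
def gammaZero (k₀ : T3) : ℝ :=
  (12 * (intI k₀ 0 / intI 0 0) - disp (rep k₀)) / (1 + intI k₀ 0 / intI 0 0)

end FockLattice

end

open MeasureTheory Set Filter Topology
open scoped ENNReal Real

noncomputable section

namespace FockLattice

/-! ### Weyl's criterion for bounded self-adjoint operators. -/

section Weyl

variable {H : Type*} [NormedAddCommGroup H] [InnerProductSpace ℂ H] [CompleteSpace H]

/-! The function w₂ takes values in [0, 18]. For real z outside this interval the second component
of (𝒜_μ - z)(f, g) = (U, V) can be solved for g, and substitution into the first leaves a Schur
complement: multiplication by Δ_μ(·; z) minus μ²/2 times the integral operator with kernel 1/(w₂ -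
z). That kernel is bounded, so the integral operator sends weakly null sequences to null sequences
and does not affect Weyl's criterion. Hence a negative z is essential exactly when Δ_μ(·; z)
vanishes somewhere (`notMem_essentialSpectrum_opA`, `mem_essentialSpectrum_opA`). The interval [0,
18] is always essential, by symmetric bumps concentrating at diagonal points
(`Icc_subset_essentialSpectrum`). The same elimination in 𝒜_μ(k) identifies its negative discrete
eigenvalues with the negative zeros of Δ_μ(k; ·).

The rest is an analysis of Δ_μ. In dimension three I(k; z) converges and is continuous up to z = 0
(`integrable_inv_disp`, `continuousOn_cubeI`), and it is nondecreasing in z ≤ 0, so Δ_μ(k; ·)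
decreases with slope at most -1. The signs of Δ_μ(·; 0) therefore decide everything below zero: if
it is negative throughout, the zeros fill a compact interval left of 0; if it takes both negative
and nonnegative values, the negative zeros fill some [E₁, 0); if it is nonnegative, there are none.
The intermediate value arguments take place on [0, π]³: representatives jump across the faces of the
cube, so w₂ need not be continuous on the torus, but the reflections of the coordinates reduce all
questions to this compact connected set (`cubeI_abs`).

The coupling satisfies (μ²/2) I(0; 0) = 12 - γ. Thus Δ_μ(0; 0) = 2γ - 12, and I(k; 0) ≤ I(0; 0)
(`intI_le_intI_zero`) makes Δ_μ(·; 0) nonnegative once γ ≥ 6, while γ < γ₀ says exactly that the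
maximum Δ_μ(k₀; 0) is negative. Above 18, a translation by half a period gives -I(k; z) ≤ I(0; 0)
(`neg_intI_le`), so Δ_μ(k; z) ≤ 18 - z < 0 and no essential spectrum appears there. -/

lemma isUnit_of_le_norm {B : H →L[ℂ] H} (hB : IsSelfAdjoint B) {c : ℝ} (hc : 0 < c)
    (h : ∀ x, c * ‖x‖ ≤ ‖B x‖) : IsUnit B := by
  rw [ContinuousLinearMap.isUnit_iff_bijective,
    ContinuousLinearMap.bijective_iff_dense_range_and_antilipschitz]
  have hK : AntilipschitzWith (Real.toNNReal c)⁻¹ B := by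
    refine B.antilipschitz_of_bound fun x => ?_
    rw [NNReal.coe_inv, Real.coe_toNNReal _ hc.le, inv_mul_eq_div, le_div_iff₀ hc, mul_comm]
    exact h x
  refine ⟨?_, _, hK⟩
  -- The range is dense because, for self-adjoint `B`, its orthogonal complement is the kernel,
  -- which the lower bound makes trivial.
  rw [Submodule.topologicalClosure_eq_top_iff, ContinuousLinearMap.orthogonal_range,
    hB.adjoint_eq, LinearMap.ker_eq_bot]
  exact hK.injective

lemma isSelfAdjoint_sub_real_smul {A : H →L[ℂ] H} (hA : IsSelfAdjoint A) (z : ℝ) :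
    IsSelfAdjoint (A - (z : ℂ) • (1 : H →L[ℂ] H)) :=
  hA.sub (IsSelfAdjoint.smul (by simp [isSelfAdjoint_iff]) (IsSelfAdjoint.one _))

omit [CompleteSpace H] in
lemma mem_spectrum_iff_not_isUnit_sub {A : H →L[ℂ] H} {z : ℂ} :
    z ∈ spectrum ℂ A ↔ ¬ IsUnit (A - z • (1 : H →L[ℂ] H)) := by
  rw [spectrum.mem_iff, ← IsUnit.neg_iff, neg_sub, Algebra.algebraMap_eq_smul_one]

omit [CompleteSpace H] in
lemma exists_le_norm_of_isUnit {B : H →L[ℂ] H} (hB : IsUnit B) :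
    ∃ C : ℝ, ∀ x, ‖x‖ ≤ C * ‖B x‖ := by
  obtain ⟨u, rfl⟩ := hB
  refine ⟨‖((u⁻¹ : (H →L[ℂ] H)ˣ) : H →L[ℂ] H)‖, fun x => ?_⟩
  have h : ((u⁻¹ : (H →L[ℂ] H)ˣ) : H →L[ℂ] H) ((u : H →L[ℂ] H) x) = x := by
    rw [← mul_apply_eq_comp, Units.inv_mul, one_apply_eq_self]
  calc ‖x‖ = ‖((u⁻¹ : (H →L[ℂ] H)ˣ) : H →L[ℂ] H) ((u : H →L[ℂ] H) x)‖ := by rw [h]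
    _ ≤ _ := ContinuousLinearMap.le_opNorm _ _

/-- At an isolated point `z` of the spectrum of a self-adjoint operator, vectors are controlled by
their image under `A - z` up to a self-adjoint operator with range in the eigenspace. -/
lemma exists_riesz_projection {A : H →L[ℂ] H} (hA : IsSelfAdjoint A) {z : ℂ}
    (hz : ∃ U ∈ 𝓝 z, U ∩ spectrum ℂ A = {z}) :
    ∃ (P : H →L[ℂ] H) (C : ℝ), (∀ x, P x ∈ Module.End.eigenspace (A : H →ₗ[ℂ] H) z) ∧
      ∀ x, ‖x - P x‖ ≤ C * ‖A x - z • x‖ := by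
  classical
  obtain ⟨U, hU, hUz⟩ := hz
  have hn : IsStarNormal A := hA.isStarNormal
  -- Since `z` is isolated, the condition `v = z` is locally constant on the spectrum. Both the
  -- indicator of `z` and the inverse of `w - z` cut off at `z` are then continuous there, so the
  -- continuous functional calculus applies to them.
  have hnear : ∀ w ∈ spectrum ℂ A, (∀ᶠ v in 𝓝[spectrum ℂ A] w, (v = z ↔ w = z)) := by
    intro w hw
    by_cases h : w = z
    · subst h
      filter_upwards [mem_nhdsWithin_of_mem_nhds hU, self_mem_nhdsWithin] with v hv hv'
      have : v ∈ U ∩ spectrum ℂ A := ⟨hv, hv'⟩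
      rw [hUz] at this
      simpa using this
    · filter_upwards [mem_nhdsWithin_of_mem_nhds (isOpen_ne.mem_nhds h)] with v hv
      simp [h]; exact hv
  have hf : ContinuousOn (fun w : ℂ => if w = z then (1 : ℂ) else 0) (spectrum ℂ A) := by
    intro w hw
    refine (continuousWithinAt_const (b := if w = z then (1 : ℂ) else 0)).congr_of_eventuallyEq
      ?_ rfl
    filter_upwards [hnear w hw] with v hv
    simp [hv]
  have hg : ContinuousOn (fun w : ℂ => if w = z then (0 : ℂ) else (w - z)⁻¹) (spectrum ℂ A) := by
    intro w hw
    by_cases h : w = z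
    · refine (continuousWithinAt_const (b := (0 : ℂ))).congr_of_eventuallyEq ?_ (by simp [h])
      filter_upwards [hnear w hw] with v hv
      simp [hv.2 h]
    · have : ContinuousWithinAt (fun w : ℂ => (w - z)⁻¹) (spectrum ℂ A) w :=
        (ContinuousAt.inv₀ (f := fun w : ℂ => w - z) (by fun_prop)
          (sub_ne_zero.2 h)).continuousWithinAt
      refine this.congr_of_eventuallyEq ?_ (by simp [h])
      filter_upwards [hnear w hw] with v hv
      rw [if_neg (fun hh => h (hv.1 hh))]
  have hid : ContinuousOn (fun w : ℂ => w - z) (spectrum ℂ A) := by fun_prop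
  have hB : cfc (fun w : ℂ => w - z) A = A - z • (1 : H →L[ℂ] H) := by
    rw [cfc_sub (fun w : ℂ => w) (fun _ => z) A, cfc_id' ℂ A, cfc_const z A,
      Algebra.algebraMap_eq_smul_one]
  refine ⟨cfc (fun w : ℂ => if w = z then (1 : ℂ) else 0) A,
    ‖cfc (fun w : ℂ => if w = z then (0 : ℂ) else (w - z)⁻¹) A‖, fun x => ?_, fun x => ?_⟩
  · have h0 : (A - z • (1 : H →L[ℂ] H)) * cfc (fun w : ℂ => if w = z then (1 : ℂ) else 0) A = 0 := by
      rw [← hB, ← cfc_mul _ _ A hid hf]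
      rw [← cfc_zero ℂ A]
      refine cfc_congr fun w _ => ?_
      by_cases h : w = z <;> simp [h]
    have h1 := congrArg (fun T : H →L[ℂ] H => T x) h0
    rw [Module.End.mem_eigenspace_iff]
    simpa [sub_eq_zero] using h1
  · have h0 : cfc (fun w : ℂ => if w = z then (0 : ℂ) else (w - z)⁻¹) A *
        (A - z • (1 : H →L[ℂ] H)) =
        1 - cfc (fun w : ℂ => if w = z then (1 : ℂ) else 0) A := by
      rw [← hB, ← cfc_mul _ _ A hg hid, ← cfc_const_one ℂ A,
        ← cfc_sub (fun _ => (1 : ℂ)) _ A continuousOn_const hf]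
      refine cfc_congr fun w _ => ?_
      by_cases h : w = z
      · simp [h]
      · simp [h, inv_mul_cancel₀ (sub_ne_zero.2 h)]
    have h1 := congrArg (fun T : H →L[ℂ] H => T x) h0
    simp only [mul_apply_eq_comp, _root_.sub_apply,
      one_apply_eq_self, _root_.smul_apply] at h1
    rw [← h1]
    exact ContinuousLinearMap.le_opNorm _ _

/-- A continuous linear map into a finite-dimensional subspace sends weakly null sequences to
null sequences. -/
lemma tendsto_zero_of_weakly_null_of_finiteDimensional {V : Submodule ℂ H}
    [FiniteDimensional ℂ V] {P : H →L[ℂ] H} (hP : ∀ x, P x ∈ V) {x : ℕ → H}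
    (hx : ∀ y, Tendsto (fun n => inner ℂ y (x n)) atTop (𝓝 0)) :
    Tendsto (fun n => P (x n)) atTop (𝓝 0) := by
  let b := stdOrthonormalBasis ℂ V
  have h : ∀ n, P (x n) = ∑ i, inner ℂ (ContinuousLinearMap.adjoint P (b i : H)) (x n) •
      (b i : H) := by
    intro n
    have h1 := b.sum_repr' ⟨P (x n), hP _⟩
    have h2 := congrArg (Subtype.val) h1
    refine (show P (x n) = _ from h2.symm).trans ?_
    simp [ContinuousLinearMap.adjoint_inner_left]
  simp_rw [h]
  have : (0 : H) = ∑ i, (0 : ℂ) • (b i : H) := by simp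
  rw [this]
  exact tendsto_finsetSum _ fun i _ => (hx _).smul_const _

/-- Weyl's criterion: a singular sequence produces a point of the essential spectrum. -/
theorem mem_essentialSpectrum_of_singular_sequence {A : H →L[ℂ] H} (hA : IsSelfAdjoint A) {z : ℂ}
    {x : ℕ → H} (hx1 : ∀ n, 1 ≤ ‖x n‖)
    (hx : ∀ y, Tendsto (fun n => inner ℂ y (x n)) atTop (𝓝 0))
    (hxz : Tendsto (fun n => A (x n) - z • x n) atTop (𝓝 0)) :
    z ∈ essentialSpectrum A := by
  have key : ¬ Tendsto x atTop (𝓝 0) := fun h => by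
    have h1 := ge_of_tendsto' h.norm hx1
    rw [norm_zero] at h1
    linarith
  refine ⟨?_, fun hd => key ?_⟩
  · rw [mem_spectrum_iff_not_isUnit_sub]
    intro hu
    obtain ⟨C, hC⟩ := exists_le_norm_of_isUnit hu
    refine key (squeeze_zero_norm (fun n => hC (x n)) ?_)
    simpa using hxz.norm.const_mul C
  · obtain ⟨_, hiso, -, hfin⟩ := hd
    obtain ⟨P, C, hP, hC⟩ := exists_riesz_projection hA hiso
    have h1 : Tendsto (fun n => x n - P (x n)) atTop (𝓝 0) := by
      refine squeeze_zero_norm (fun n => hC (x n)) ?_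
      simpa using hxz.norm.const_mul C
    have h2 := tendsto_zero_of_weakly_null_of_finiteDimensional hP hx
    simpa using h1.add h2

omit [CompleteSpace H] in
lemma exists_orthonormal_nat_of_not_finiteDimensional {V : Submodule ℂ H} [CompleteSpace V]
    (hV : ¬ FiniteDimensional ℂ V) : ∃ x : ℕ → V, Orthonormal ℂ x := by
  obtain ⟨w, b, hb⟩ := exists_hilbertBasis ℂ V
  have hw : Infinite w := by
    by_contra h
    rw [not_infinite_iff_finite] at h
    have := Fintype.ofFinite w
    exact hV (Module.Basis.finiteDimensional_of_finite b.toOrthonormalBasis.toBasis)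
  exact ⟨_, b.orthonormal.comp _ (Infinite.natEmbedding w).injective⟩

/-- Weyl's criterion: every point of the essential spectrum has a singular sequence. -/
theorem exists_singular_sequence_of_mem_essentialSpectrum {A : H →L[ℂ] H} (hA : IsSelfAdjoint A)
    {z : ℝ} (hz : (z : ℂ) ∈ essentialSpectrum A) :
    ∃ x : ℕ → H, (∀ n, ‖x n‖ = 1) ∧
      (∀ y, Tendsto (fun n => inner ℂ y (x n)) atTop (𝓝 0)) ∧
      Tendsto (fun n => A (x n) - (z : ℂ) • x n) atTop (𝓝 0) := by
  by_contra hno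
  obtain ⟨hsp, hnd⟩ := hz
  set B : H →L[ℂ] H := A - (z : ℂ) • (1 : H →L[ℂ] H) with hBdef
  have hB : IsSelfAdjoint B := isSelfAdjoint_sub_real_smul hA z
  have hBx : ∀ x, B x = A x - (z : ℂ) • x := fun x => by simp [hBdef]
  have hBsym : ∀ x y, inner ℂ (B x) y = inner ℂ x (B y) := fun x y => by
    rw [← ContinuousLinearMap.adjoint_inner_right, hB.adjoint_eq]
  set N : Submodule ℂ H := LinearMap.ker (B : H →ₗ[ℂ] H) with hN
  have hNE : N = Module.End.eigenspace (A : H →ₗ[ℂ] H) (z : ℂ) := by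
    ext x
    rw [Module.End.mem_eigenspace_iff, hN, LinearMap.mem_ker]
    simp [hBx, sub_eq_zero]
  have hNcl : IsClosed (N : Set H) := B.isClosed_ker
  have : CompleteSpace N := hNcl.completeSpace_coe
  have hBN : ∀ x ∈ N, B x = 0 := fun x hx => hx
  have hfin : FiniteDimensional ℂ N := by
    by_contra hinf
    -- An orthonormal sequence in an infinite-dimensional kernel is weakly null by Bessel's
    -- inequality, hence singular.
    obtain ⟨x, hx⟩ := exists_orthonormal_nat_of_not_finiteDimensional hinf
    have hx' : Orthonormal ℂ (fun n => (x n : H)) := hx.comp_linearIsometry N.subtypeₗᵢ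
    refine hno ⟨fun n => x n, hx'.1, fun y => ?_, ?_⟩
    · have h1 := (hx'.inner_products_summable y).tendsto_cofinite_zero
      rw [Nat.cofinite_eq_atTop] at h1
      have h2 := h1.sqrt
      simp only [Real.sqrt_sq (norm_nonneg _), Real.sqrt_zero] at h2
      rw [tendsto_zero_iff_norm_tendsto_zero]
      simpa only [norm_inner_symm y] using h2
    · have : ∀ n, A (x n) - (z : ℂ) • (x n : H) = 0 := fun n => by
        rw [← hBx]; exact hBN _ (x n).2
      simp_rw [this]
      exact tendsto_const_nhds
  have hbdd : ∃ c : ℝ, 0 < c ∧ ∀ x ∈ Nᗮ, c * ‖x‖ ≤ ‖B x‖ := by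
    by_contra! hcon
    have hsel : ∀ n : ℕ, ∃ x ∈ Nᗮ, ‖x‖ = 1 ∧ ‖B x‖ ≤ 1 / ((n : ℝ) + 1) := by
      intro n
      obtain ⟨x, hxN, hx⟩ := hcon (1 / ((n : ℝ) + 1)) (by positivity)
      have hx0 : x ≠ 0 := by
        rintro rfl
        simp at hx
      have hxn : 0 < ‖x‖ := norm_pos_iff.2 hx0
      refine ⟨((‖x‖⁻¹ : ℝ) : ℂ) • x, Nᗮ.smul_mem _ hxN, ?_, ?_⟩
      · rw [norm_smul, Complex.norm_real, norm_inv, norm_norm, inv_mul_cancel₀ hxn.ne']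
      · rw [map_smul, norm_smul, Complex.norm_real, norm_inv, norm_norm, inv_mul_le_iff₀ hxn]
        linarith
    choose x hxN hx1 hxB using hsel
    have hBto : Tendsto (fun n => B (x n)) atTop (𝓝 0) :=
      squeeze_zero_norm hxB tendsto_one_div_add_atTop_nhds_zero_nat
    refine hno ⟨x, hx1, fun y => ?_, by simpa only [hBx] using hBto⟩
    -- Weak nullity of the bounded sequence `x` need only be tested on a dense subspace. It is
    -- orthogonal to `N`, and pairing with `B w` equals pairing `w` with `B (x n)`, which tends to
    -- zero; `N` and the range of `B` together span a dense subspace because the range has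
    -- orthogonal complement `N`.
    have hdense : Dense ((N ⊔ LinearMap.range (B : H →ₗ[ℂ] H) : Submodule ℂ H) : Set H) := by
      rw [Submodule.dense_iff_topologicalClosure_eq_top, Submodule.topologicalClosure_eq_top_iff,
        ← Submodule.inf_orthogonal, ContinuousLinearMap.orthogonal_range, hB.adjoint_eq]
      exact (Submodule.orthogonal_disjoint N).symm.eq_bot
    rw [Metric.tendsto_atTop]
    intro ε hε
    obtain ⟨y', hy', hyy'⟩ := Metric.dense_iff.1 hdense y (ε / 2) (half_pos hε)
    rw [Metric.mem_ball, dist_eq_norm] at hy'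
    obtain ⟨p, hp, q, ⟨w, rfl⟩, rfl⟩ := Submodule.mem_sup.1 hyy'
    have hlim : Tendsto (fun n => ‖w‖ * ‖B (x n)‖) atTop (𝓝 0) := by
      simpa using hBto.norm.const_mul ‖w‖
    obtain ⟨n₀, hn₀⟩ := (Metric.tendsto_atTop.1 hlim) (ε / 2) (half_pos hε)
    refine ⟨n₀, fun n hn => ?_⟩
    have h1 := hn₀ n hn
    rw [Real.dist_eq, sub_zero, abs_of_nonneg (by positivity)] at h1
    rw [dist_zero_right]
    have h2 : inner ℂ y (x n) = -inner ℂ (p + (B : H →ₗ[ℂ] H) w - y) (x n) + inner ℂ w (B (x n)) := by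
      have h3 : inner ℂ p (x n) = 0 := (Submodule.mem_orthogonal N _).1 (hxN n) p hp
      rw [inner_sub_left, inner_add_left, h3, ← hBsym]
      simp
    have h3 : ‖inner ℂ (p + (B : H →ₗ[ℂ] H) w - y) (x n)‖ < ε / 2 :=
      (norm_inner_le_norm _ _).trans_lt (by rw [hx1, mul_one]; exact hy')
    have h4 : ‖inner ℂ w (B (x n))‖ ≤ ‖w‖ * ‖B (x n)‖ := norm_inner_le_norm _ _
    rw [h2]
    refine (norm_add_le _ _).trans_lt ?_
    rw [norm_neg]
    linarith
  obtain ⟨c, hc, hcB⟩ := hbdd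
  refine hnd ⟨hsp, ⟨Metric.ball (z : ℂ) c, Metric.ball_mem_nhds _ hc, ?_⟩, ?_, hNE ▸ hfin⟩
  · refine Subset.antisymm ?_ (by
      rintro w rfl
      exact ⟨Metric.mem_ball_self hc, hsp⟩)
    rintro w ⟨hwc, hw⟩
    by_contra hwz
    rw [mem_singleton_iff] at hwz
    have hre : w = (w.re : ℂ) := hA.mem_spectrum_eq_re hw
    set r := w.re with hr
    have hd : 0 < |z - r| := abs_pos.2 fun h => hwz (by rw [hre, ← sub_eq_zero.1 h])
    have hdc : |z - r| < c := by
      rw [hre, Metric.mem_ball, Complex.dist_eq, ← Complex.ofReal_sub, Complex.norm_real,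
        Real.norm_eq_abs, abs_sub_comm] at hwc
      exact hwc
    rw [hre] at hw
    -- Both `N` and `Nᗮ` are invariant. On `N` the operator `A - r` is the scalar `z - r`; on `Nᗮ`
    -- it differs from `B` by that scalar and so is bounded below by `c - |z - r|`.
    refine mem_spectrum_iff_not_isUnit_sub.1 hw
      (isUnit_of_le_norm (isSelfAdjoint_sub_real_smul hA r) (c := min |z - r| (c - |z - r|))
        (lt_min hd (by linarith)) fun x => ?_)
    obtain ⟨p, hp, q, hq, rfl⟩ := N.exists_add_mem_mem_orthogonal x
    have hBq : B q ∈ Nᗮ := by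
      rw [Submodule.mem_orthogonal]
      intro u hu
      rw [← hBsym, hBN u hu, inner_zero_left]
    have hAx : (A - (r : ℂ) • (1 : H →L[ℂ] H)) (p + q) =
        ((z - r : ℝ) : ℂ) • p + (B q + ((z - r : ℝ) : ℂ) • q) := by
      have e1 : A p = (z : ℂ) • p := by rw [← sub_eq_zero, ← hBx, hBN p hp]
      simp only [_root_.sub_apply, _root_.smul_apply,
        one_apply_eq_self, map_add, hBx, e1, Complex.ofReal_sub]
      module
    have hq2 : B q + ((z - r : ℝ) : ℂ) • q ∈ Nᗮ := Nᗮ.add_mem hBq (Nᗮ.smul_mem _ hq)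
    have ho1 : ‖p + q‖ * ‖p + q‖ = ‖p‖ * ‖p‖ + ‖q‖ * ‖q‖ :=
      norm_add_sq_eq_norm_sq_add_norm_sq_of_inner_eq_zero _ _
        ((Submodule.mem_orthogonal N _).1 hq p hp)
    have ho2 := norm_add_sq_eq_norm_sq_add_norm_sq_of_inner_eq_zero (((z - r : ℝ) : ℂ) • p) _
      ((Submodule.mem_orthogonal N _).1 hq2 _ (N.smul_mem ((z - r : ℝ) : ℂ) hp))
    rw [hAx]
    set m := min |z - r| (c - |z - r|) with hm
    have hm0 : 0 < m := lt_min hd (by linarith)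
    have h1 : m * ‖p‖ ≤ ‖((z - r : ℝ) : ℂ) • p‖ := by
      rw [norm_smul, Complex.norm_real, Real.norm_eq_abs]
      exact mul_le_mul_of_nonneg_right (min_le_left _ _) (norm_nonneg _)
    have h2 : m * ‖q‖ ≤ ‖B q + ((z - r : ℝ) : ℂ) • q‖ := by
      have e1 : ‖B q‖ ≤ ‖B q + ((z - r : ℝ) : ℂ) • q‖ + ‖((z - r : ℝ) : ℂ) • q‖ := by
        simpa using norm_sub_le (B q + ((z - r : ℝ) : ℂ) • q) (((z - r : ℝ) : ℂ) • q)
      rw [norm_smul, Complex.norm_real, Real.norm_eq_abs] at e1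
      have e2 : m * ‖q‖ ≤ (c - |z - r|) * ‖q‖ :=
        mul_le_mul_of_nonneg_right (min_le_right _ _) (norm_nonneg _)
      linarith [hcB q hq]
    refine le_of_sq_le_sq ?_ (norm_nonneg _)
    have h1' := mul_self_le_mul_self (by positivity) h1
    have h2' := mul_self_le_mul_self (by positivity) h2
    calc (m * ‖p + q‖) ^ 2 = m * m * (‖p + q‖ * ‖p + q‖) := by ring
      _ = m * ‖p‖ * (m * ‖p‖) + m * ‖q‖ * (m * ‖q‖) := by rw [ho1]; ring
      _ ≤ _ := by rw [sq, ho2]; exact add_le_add h1' h2'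
  · rw [Module.End.hasEigenvalue_iff, ← hNE]
    intro hbot
    refine mem_spectrum_iff_not_isUnit_sub.1 hsp (isUnit_of_le_norm hB hc fun x => hcB x ?_)
    rw [hbot, Submodule.bot_orthogonal_eq_top]
    exact Submodule.mem_top

lemma eq_re_of_mem_essentialSpectrum {A : H →L[ℂ] H} (hA : IsSelfAdjoint A) {w : ℂ}
    (hw : w ∈ essentialSpectrum A) : w = w.re :=
  hA.mem_spectrum_eq_re hw.1

end Weyl

/-! ### Self-adjointness and convergence in a Hilbert direct sum. -/

section BlockOperators

variable {E F : Type*} [NormedAddCommGroup E] [InnerProductSpace ℂ E] [CompleteSpace E]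
  [NormedAddCommGroup F] [InnerProductSpace ℂ F] [CompleteSpace F]

lemma isSelfAdjoint_blockOp {A : E →L[ℂ] E} (hA : IsSelfAdjoint A) (B : F →L[ℂ] E)
    {D : F →L[ℂ] F} (hD : IsSelfAdjoint D) :
    IsSelfAdjoint (blockOp A B (ContinuousLinearMap.adjoint B) D) := by
  rw [ContinuousLinearMap.isSelfAdjoint_iff_isSymmetric] at *
  intro x y
  have h1 := hA x.fst y.fst
  have h2 := hD x.snd y.snd
  simp only [ContinuousLinearMap.coe_coe] at h1 h2 ⊢
  change inner ℂ (blockOp _ _ _ _ (WithLp.toLp 2 (x.fst, x.snd))) y =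
    inner ℂ x (blockOp _ _ _ _ (WithLp.toLp 2 (y.fst, y.snd)))
  rw [blockOp_apply, blockOp_apply, WithLp.prod_inner_apply, WithLp.prod_inner_apply]
  simp only [WithLp.ofLp_fst, WithLp.ofLp_snd, inner_add_left, inner_add_right, h1, h2, ContinuousLinearMap.adjoint_inner_left,
    ContinuousLinearMap.adjoint_inner_right]
  ring

omit [CompleteSpace E] [CompleteSpace F] in
lemma tendsto_toLp_prod {x : ℕ → E} {y : ℕ → F} (hx : Tendsto x atTop (𝓝 0))
    (hy : Tendsto y atTop (𝓝 0)) :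
    Tendsto (fun n => WithLp.toLp 2 (x n, y n)) atTop (𝓝 (0 : WithLp 2 (E × F))) := by
  have := ((WithLp.prodContinuousLinearEquiv 2 ℂ E F).symm.continuous.tendsto (0, 0)).comp
    (hx.prodMk_nhds hy)
  exact this

omit [CompleteSpace E] [CompleteSpace F] in
lemma tendsto_fst_of_tendsto {x : ℕ → WithLp 2 (E × F)} (hx : Tendsto x atTop (𝓝 0)) :
    Tendsto (fun n => (x n).fst) atTop (𝓝 0) :=
  ((continuous_fst.comp (WithLp.prodContinuousLinearEquiv 2 ℂ E F).continuous).tendsto 0).comp hx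

omit [CompleteSpace E] [CompleteSpace F] in
lemma tendsto_snd_of_tendsto {x : ℕ → WithLp 2 (E × F)} (hx : Tendsto x atTop (𝓝 0)) :
    Tendsto (fun n => (x n).snd) atTop (𝓝 0) :=
  ((continuous_snd.comp (WithLp.prodContinuousLinearEquiv 2 ℂ E F).continuous).tendsto 0).comp hx

omit [CompleteSpace E] [CompleteSpace F] in
lemma weakly_null_fst {x : ℕ → WithLp 2 (E × F)}
    (hx : ∀ y, Tendsto (fun n => inner ℂ y (x n)) atTop (𝓝 0)) (y : E) :
    Tendsto (fun n => inner ℂ y (x n).fst) atTop (𝓝 0) := by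
  simpa [WithLp.prod_inner_apply] using hx (WithLp.toLp 2 (y, 0))

omit [CompleteSpace E] [CompleteSpace F] in
lemma weakly_null_toLp_prod {x : ℕ → E} {y : ℕ → F}
    (hx : ∀ u, Tendsto (fun n => inner ℂ u (x n)) atTop (𝓝 0))
    (hy : ∀ u, Tendsto (fun n => inner ℂ u (y n)) atTop (𝓝 0)) (u : WithLp 2 (E × F)) :
    Tendsto (fun n => inner ℂ u (WithLp.toLp 2 (x n, y n))) atTop (𝓝 0) := by
  simpa [WithLp.prod_inner_apply] using (hx u.fst).add (hy u.snd)

lemma weakly_null_map {x : ℕ → E} (hx : ∀ u, Tendsto (fun n => inner ℂ u (x n)) atTop (𝓝 0))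
    (T : E →L[ℂ] F) (u : F) : Tendsto (fun n => inner ℂ u (T (x n))) atTop (𝓝 0) := by
  simpa [ContinuousLinearMap.adjoint_inner_left] using hx (ContinuousLinearMap.adjoint T u)

end BlockOperators

/-! ### Multiplication and integral operators in L₂. -/

section LpOperators

variable {X : Type*} [MeasurableSpace X] {ν : Measure X}

lemma isSelfAdjoint_mulOp (w : X → ℝ) (hw : MemLp (fun x => (w x : ℂ)) ∞ ν) :
    IsSelfAdjoint (mulOp (fun x => (w x : ℂ)) hw) := by
  rw [ContinuousLinearMap.isSelfAdjoint_iff_isSymmetric]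
  intro f g
  rw [ContinuousLinearMap.coe_coe, L2.inner_def, L2.inner_def]
  refine integral_congr_ae ?_
  filter_upwards [mulOp_apply _ hw f, mulOp_apply _ hw g] with x h1 h2
  rw [h1, h2]
  simp only [RCLike.inner_apply, map_mul, Complex.conj_ofReal]
  ring

lemma isSelfAdjoint_symMulOp [IsFiniteMeasure ν] (w : X × X → ℝ)
    (hw : MemLp (fun x => (w x : ℂ)) ∞ (ν.prod ν)) (hsym : ∀ x : X × X, (w x.swap : ℂ) = w x) :
    IsSelfAdjoint (symMulOp (fun x => (w x : ℂ)) hw hsym) := by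
  rw [ContinuousLinearMap.isSelfAdjoint_iff_isSymmetric]
  intro f g
  have h := (ContinuousLinearMap.isSelfAdjoint_iff_isSymmetric.1 (isSelfAdjoint_mulOp w hw))
    (f : Lp ℂ 2 (ν.prod ν)) (g : Lp ℂ 2 (ν.prod ν))
  exact h

lemma norm_mulOp_le {w : X → ℂ} (hw : MemLp w ∞ ν) (f : Lp ℂ 2 ν) {c : ℝ}
    (h : ∀ᵐ x ∂ν, f x ≠ 0 → ‖w x‖ ≤ c) : ‖mulOp w hw f‖ ≤ c * ‖f‖ := by
  refine Lp.norm_le_mul_norm_of_ae_le_mul ?_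
  filter_upwards [mulOp_apply w hw f, h] with x h1 h2
  rw [h1, norm_mul]
  by_cases h0 : f x = 0
  · simp [h0]
  · exact mul_le_mul_of_nonneg_right (h2 h0) (norm_nonneg _)

lemma le_norm_mulOp {w : X → ℂ} (hw : MemLp w ∞ ν) (f : Lp ℂ 2 ν) {c : ℝ} (hc : 0 < c)
    (h : ∀ x, c ≤ ‖w x‖) : c * ‖f‖ ≤ ‖mulOp w hw f‖ := by
  rw [← le_inv_mul_iff₀ hc]
  refine Lp.norm_le_mul_norm_of_ae_le_mul ?_
  filter_upwards [mulOp_apply w hw f] with x h1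
  rw [h1, norm_mul, le_inv_mul_iff₀ hc]
  exact mul_le_mul_of_nonneg_right (h x) (norm_nonneg _)

lemma adjoint_integralFunctional_apply [IsFiniteMeasure ν] (a : ℂ) :
    ContinuousLinearMap.adjoint (integralFunctional ν) a =ᵐ[ν] fun _ => a := by
  have : ContinuousLinearMap.adjoint (integralFunctional ν) a = Lp.const 2 ν a := by
    refine ext_inner_left ℂ fun f => ?_
    rw [ContinuousLinearMap.adjoint_inner_right, integralFunctional_apply, L2.inner_def,
      RCLike.inner_apply, ← integral_conj, ← integral_const_mul]
    refine integral_congr_ae ?_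
    filter_upwards [Lp.coeFn_const (p := 2) (μ := ν) a] with x hx
    rw [hx]
    simp
  rw [this]
  exact Lp.coeFn_const (p := 2) (μ := ν) a

/-- The element `(k, p) ↦ f(p)` of `L₂(X × X)`. -/
def pullSnd [IsFiniteMeasure ν] (f : Lp ℂ 2 ν) : Lp ℂ 2 (ν.prod ν) :=
  ((Lp.memLp f).comp_snd ν).toLp _

lemma pullSnd_apply [IsFiniteMeasure ν] (f : Lp ℂ 2 ν) :
    pullSnd f =ᵐ[ν.prod ν] fun x => f x.2 :=
  ((Lp.memLp f).comp_snd ν).coeFn_toLp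

/-- The integral operator with bounded kernel `κ`. -/
def kerOp [IsFiniteMeasure ν] (κ : X × X → ℂ) (hκ : MemLp κ ∞ (ν.prod ν)) (f : Lp ℂ 2 ν) :
    Lp ℂ 2 ν :=
  integrateSnd ν (mulOp κ hκ (pullSnd f))

lemma kerOp_apply [IsFiniteMeasure ν] (κ : X × X → ℂ) (hκ : MemLp κ ∞ (ν.prod ν))
    (f : Lp ℂ 2 ν) : kerOp κ hκ f =ᵐ[ν] fun k => ∫ s, κ (k, s) * f s ∂ν := by
  filter_upwards [integrateSnd_apply (mulOp κ hκ (pullSnd f)),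
    Measure.ae_ae_of_ae_prod (mulOp_apply κ hκ (pullSnd f)),
    Measure.ae_ae_of_ae_prod (pullSnd_apply f)] with k h1 h2 h3
  rw [kerOp, h1]
  refine integral_congr_ae ?_
  filter_upwards [h2, h3] with s h4 h5
  rw [h4, h5]

lemma norm_sq_eq_integral (f : Lp ℂ 2 ν) : ‖f‖ ^ 2 = ∫ x, ‖f x‖ ^ 2 ∂ν := by
  have h := L2.inner_def (𝕜 := ℂ) f f
  rw [inner_self_eq_norm_sq_to_K] at h
  have h2 : ∀ x, inner ℂ (f x) (f x) = ((‖f x‖ ^ 2 : ℝ) : ℂ) := fun x => by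
    rw [inner_self_eq_norm_sq_to_K]; norm_cast
  simp_rw [h2] at h
  rw [integral_complex_ofReal] at h
  refine Complex.ofReal_injective (Eq.trans ?_ h)
  push_cast
  rfl

/-- Integral operators with bounded kernels are completely continuous. -/
lemma tendsto_kerOp [IsFiniteMeasure ν] {κ : X × X → ℂ} (hκ : MemLp κ ∞ (ν.prod ν))
    (hm : Measurable κ) {C : ℝ} (hC : ∀ x, ‖κ x‖ ≤ C) {f : ℕ → Lp ℂ 2 ν} {M : ℝ}
    (hM : ∀ n, ‖f n‖ ≤ M) (hf : ∀ y, Tendsto (fun n => inner ℂ y (f n)) atTop (𝓝 0)) :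
    Tendsto (fun n => kerOp κ hκ (f n)) atTop (𝓝 0) := by
  -- The image of `f n` at `k` is the pairing of `f n` with the conjugated row `κ (k, ·)`, so it
  -- tends to zero for almost every `k`. The rows are uniformly bounded in L₂, and dominated
  -- convergence on the finite measure space turns this into norm convergence.
  have hmem : ∀ k, MemLp (fun s => (starRingEnd ℂ) (κ (k, s))) 2 ν := fun k => by
    refine MemLp.of_bound ?_ C (Eventually.of_forall fun s => ?_)
    · exact (Complex.continuous_conj.measurable.comp
        (hm.comp measurable_prodMk_left)).aestronglyMeasurable
    · rw [RCLike.norm_conj]; exact hC _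
  have hin : ∀ n, ∀ᵐ k ∂ν, kerOp κ hκ (f n) k = inner ℂ ((hmem k).toLp _) (f n) := fun n => by
    filter_upwards [kerOp_apply κ hκ (f n)] with k hk
    rw [hk, L2.inner_def]
    refine integral_congr_ae ?_
    filter_upwards [(hmem k).coeFn_toLp] with s hs
    rw [hs, RCLike.inner_apply]
    simp [mul_comm]
  have hall : ∀ᵐ k ∂ν, ∀ n, kerOp κ hκ (f n) k = inner ℂ ((hmem k).toLp _) (f n) :=
    ae_all_iff.2 hin
  set C' : ℝ := (measureUnivNNReal ν : ℝ) ^ ((2 : ℝ≥0∞).toReal)⁻¹ * |C| with hC'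
  have hnorm : ∀ k, ‖(hmem k).toLp _‖ ≤ C' := fun k => by
    refine Lp.norm_le_of_ae_bound (abs_nonneg C) ?_
    filter_upwards [(hmem k).coeFn_toLp] with s hs
    rw [hs, RCLike.norm_conj]
    exact (hC _).trans (le_abs_self C)
  have hsq : Tendsto (fun n => ‖kerOp κ hκ (f n)‖ ^ 2) atTop (𝓝 0) := by
    simp_rw [norm_sq_eq_integral]
    have h0 : (0 : ℝ) = ∫ _ : X, (0 : ℝ) ∂ν := by simp
    rw [h0]
    refine tendsto_integral_of_dominated_convergence (fun _ => (C' * M) ^ 2)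
      (fun n => ((Lp.aestronglyMeasurable _).norm.pow 2)) (integrable_const _) ?_ ?_
    · intro n
      filter_upwards [hin n] with k hk
      rw [hk, Real.norm_eq_abs, abs_of_nonneg (by positivity)]
      refine pow_le_pow_left₀ (norm_nonneg _) ((norm_inner_le_norm _ _).trans ?_) 2
      exact mul_le_mul (hnorm k) (hM n) (norm_nonneg _) ((norm_nonneg _).trans (hnorm k))
    · filter_upwards [hall] with k hk
      simp_rw [hk]
      simpa using ((hf ((hmem k).toLp _)).norm.pow 2)
  rw [tendsto_zero_iff_norm_tendsto_zero]
  have := hsq.sqrt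
  simpa [Real.sqrt_sq (norm_nonneg _)] using this

end LpOperators

/-! ### The adjoint of the annihilation operator -/

lemma memLp_symmetrization (f : H1) :
    MemLp (fun x : T3 × T3 => (f x.1 + f x.2) / 2) 2
      ((volume : Measure T3).prod (volume : Measure T3)) := by
  have := (((Lp.memLp f).comp_fst volume).add ((Lp.memLp f).comp_snd volume)).const_mul (2⁻¹ : ℂ)
  refine (memLp_congr_ae (Eventually.of_forall fun x => ?_)).1 this
  simp [div_eq_inv_mul]

/-- Against a symmetric function, f(k) and f(p) have the same pairing, so their average, which lies
in the symmetric subspace, represents the functional. This factor 1/2 is the origin of μ²/2 in the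
Fredholm determinant and of μ/√2 in the Friedrichs model. -/
lemma adjoint_A12_apply (f : H1) :
    (ContinuousLinearMap.adjoint A12 f).1 =ᵐ[(volume : Measure T3).prod volume]
      fun x => (f x.1 + f x.2) / 2 := by
  set g : Lp ℂ 2 ((volume : Measure T3).prod (volume : Measure T3)) :=
    (memLp_symmetrization f).toLp _ with hg
  have hgx := (memLp_symmetrization f).coeFn_toLp
  have hswap := Measure.measurePreserving_swap (μ := (volume : Measure T3))
    (ν := (volume : Measure T3))
  have hgs : g ∈ symL2 (volume : Measure T3) := by
    rw [mem_symL2]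
    filter_upwards [hgx, hswap.quasiMeasurePreserving.ae hgx] with x h1 h2
    rw [h1, h2, Prod.fst_swap, Prod.snd_swap, add_comm]
  have key : ContinuousLinearMap.adjoint A12 f = ⟨g, hgs⟩ := by
    refine ext_inner_left ℂ fun h => ?_
    rw [ContinuousLinearMap.adjoint_inner_right]
    change inner ℂ (integrateSnd volume h.1) f = inner ℂ h.1 g
    rw [L2.inner_def, L2.inner_def]
    have hint1 : Integrable (fun x : T3 × T3 => f x.1 * (starRingEnd ℂ) (h.1 x))
        ((volume : Measure T3).prod volume) := by
      refine MemLp.integrable_mul (p := 2) (q := 2) ((Lp.memLp f).comp_fst volume) ?_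
      exact (Lp.memLp h.1).star
    have hint2 : Integrable (fun x : T3 × T3 => f x.2 * (starRingEnd ℂ) (h.1 x))
        ((volume : Measure T3).prod volume) := by
      refine MemLp.integrable_mul (p := 2) (q := 2) ((Lp.memLp f).comp_snd volume) ?_
      exact (Lp.memLp h.1).star
    have heq : ∫ x : T3 × T3, f x.2 * (starRingEnd ℂ) (h.1 x)
          ∂((volume : Measure T3).prod volume) =
        ∫ x : T3 × T3, f x.1 * (starRingEnd ℂ) (h.1 x)
          ∂((volume : Measure T3).prod volume) := by
      rw [← integral_prod_swap]
      refine integral_congr_ae ?_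
      filter_upwards [mem_symL2.1 h.2] with x hx
      rw [hx, Prod.snd_swap]
    have h1 : ∫ x, inner ℂ (h.1 x) (g x) ∂((volume : Measure T3).prod volume) =
        ∫ x : T3 × T3, f x.1 * (starRingEnd ℂ) (h.1 x)
          ∂((volume : Measure T3).prod volume) := by
      have h2 : ∫ x, inner ℂ (h.1 x) (g x) ∂((volume : Measure T3).prod volume) =
          ∫ x : T3 × T3, (2⁻¹ * (f x.1 * (starRingEnd ℂ) (h.1 x)) +
            2⁻¹ * (f x.2 * (starRingEnd ℂ) (h.1 x)))
          ∂((volume : Measure T3).prod volume) := by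
        refine integral_congr_ae ?_
        filter_upwards [hgx] with x hx
        rw [hx, RCLike.inner_apply]
        ring
      rw [h2, integral_add (hint1.const_mul _) (hint2.const_mul _), integral_const_mul,
        integral_const_mul, heq]
      ring
    rw [h1, integral_prod _ hint1]
    refine integral_congr_ae ?_
    filter_upwards [integrateSnd_apply h.1] with k hk
    rw [hk, RCLike.inner_apply, integral_const_mul, integral_conj]
  rw [key]
  exact hgx

lemma A12_apply (f : H2) : A12 f =ᵐ[volume] fun k => ∫ s, f.1 (k, s) :=
  integrateSnd_apply _

lemma isSelfAdjoint_opA (μ γ : ℝ) : IsSelfAdjoint (opA μ γ) := by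
  have h : ((μ : ℂ) • ContinuousLinearMap.adjoint A12) =
      ContinuousLinearMap.adjoint ((μ : ℂ) • A12) := by
    rw [map_smulₛₗ, Complex.conj_ofReal]
  rw [opA, h]
  exact isSelfAdjoint_blockOp (isSelfAdjoint_mulOp (w1 γ) _) _
    (isSelfAdjoint_symMulOp (fun x => w2 x.1 x.2) _ _)

lemma isSelfAdjoint_friedrichs (μ γ : ℝ) (k : T3) : IsSelfAdjoint (friedrichs μ γ k) := by
  have h : (((μ / √2 : ℝ) : ℂ) • ContinuousLinearMap.adjoint
        (integralFunctional (volume : Measure T3))) =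
      ContinuousLinearMap.adjoint (((μ / √2 : ℝ) : ℂ) •
        integralFunctional (volume : Measure T3)) := by
    rw [map_smulₛₗ, Complex.conj_ofReal]
  rw [friedrichs, h]
  refine isSelfAdjoint_blockOp ?_ _ (isSelfAdjoint_mulOp (fun p => w2 k p) _)
  exact IsSelfAdjoint.smul (by simp [isSelfAdjoint_iff]) (IsSelfAdjoint.one _)

/-! ### Bounds on w₂ and the kernel 1/(w₂ - z). -/

lemma disp_nonneg (q : Fin 3 → ℝ) : 0 ≤ disp q :=
  Finset.sum_nonneg fun _ _ => sub_nonneg.2 (Real.cos_le_one _)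

lemma w2_nonneg (k p : T3) : 0 ≤ w2 k p :=
  add_nonneg (add_nonneg (disp_nonneg _) (disp_nonneg _)) (disp_nonneg _)

lemma w2_le (k p : T3) : w2 k p ≤ 18 := (abs_le.1 (abs_w2_le k p)).2

lemma exists_le_abs_w2_sub {z : ℝ} (hz : z ∉ Icc (0 : ℝ) 18) :
    ∃ d > 0, ∀ k p, d ≤ |w2 k p - z| := by
  rw [mem_Icc, not_and_or, not_le, not_le] at hz
  rcases hz with hz | hz
  · exact ⟨-z, by linarith, fun k p => le_abs.2 (Or.inl (by linarith [w2_nonneg k p]))⟩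
  · exact ⟨z - 18, by linarith, fun k p => le_abs.2 (Or.inr (by linarith [w2_le k p]))⟩

lemma w2_sub_ne_zero {z : ℝ} (hz : z ∉ Icc (0 : ℝ) 18) (k p : T3) : w2 k p - z ≠ 0 := by
  obtain ⟨d, hd, h⟩ := exists_le_abs_w2_sub hz
  exact abs_pos.1 (hd.trans_le (h k p))

/-- The kernel `1 / (w₂(k, p) - z)`. -/
def resKer (z : ℝ) (x : T3 × T3) : ℂ := ((1 / (w2 x.1 x.2 - z) : ℝ) : ℂ)

lemma measurable_resKer (z : ℝ) : Measurable (resKer z) :=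
  Complex.measurable_ofReal.comp ((measurable_w2.sub_const z).const_div 1)

lemma exists_norm_resKer_le {z : ℝ} (hz : z ∉ Icc (0 : ℝ) 18) :
    ∃ C > 0, ∀ x, ‖resKer z x‖ ≤ C := by
  obtain ⟨d, hd, h⟩ := exists_le_abs_w2_sub hz
  refine ⟨1 / d, by positivity, fun x => ?_⟩
  rw [resKer, Complex.norm_real, norm_div, norm_one, Real.norm_eq_abs]
  exact one_div_le_one_div_of_le hd (h _ _)

lemma memLp_resKer {z : ℝ} (hz : z ∉ Icc (0 : ℝ) 18) :
    MemLp (resKer z) ∞ ((volume : Measure T3).prod (volume : Measure T3)) := by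
  obtain ⟨C, -, hC⟩ := exists_norm_resKer_le hz
  exact memLp_top_of_bound (measurable_resKer z).aestronglyMeasurable C (Eventually.of_forall hC)

lemma resKer_swap (z : ℝ) (x : T3 × T3) : resKer z x.swap = resKer z x := by
  rw [resKer, resKer, Prod.fst_swap, Prod.snd_swap, w2_comm]

lemma integrable_resKer_section {z : ℝ} (hz : z ∉ Icc (0 : ℝ) 18) (k : T3) :
    Integrable (fun s => resKer z (k, s)) := by
  obtain ⟨C, -, hC⟩ := exists_norm_resKer_le hz
  exact Integrable.of_bound
    ((measurable_resKer z).comp measurable_prodMk_left).aestronglyMeasurable C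
    (Eventually.of_forall fun s => hC _)

lemma integral_resKer_section (z : ℝ) (k : T3) : ∫ s, resKer z (k, s) = (intI k z : ℂ) :=
  integral_complex_ofReal

lemma memLp_fredDet (μ γ : ℝ) {z : ℝ} (hz : z ∉ Icc (0 : ℝ) 18) :
    MemLp (fun k : T3 => (fredDet μ γ k z : ℂ)) ∞ volume := by
  obtain ⟨C, hC0, hC⟩ := exists_norm_resKer_le hz
  have h1 : MemLp (fun k : T3 => (intI k z : ℂ)) ∞ volume := by
    simp_rw [← integral_resKer_section]
    refine memLp_top_of_bound ?_ (C * (volume : Measure T3).real univ)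
      (Eventually.of_forall fun k => norm_integral_le_of_norm_le_const
        (Eventually.of_forall fun s => hC _))
    exact (measurable_resKer z).stronglyMeasurable.integral_prod_right'.aestronglyMeasurable
  have h2 := ((memLp_w1 γ).sub (memLp_const (z : ℂ))).sub (h1.const_mul ((μ : ℂ) ^ 2 / 2))
  refine (memLp_congr_ae (Eventually.of_forall fun k => ?_)).1 h2
  simp [fredDet]

/-! ### The Schur complement and the essential spectrum off [0, 18]. -/

lemma opA_sub_smul (μ γ : ℝ) (z : ℂ) (f : H1) (g : H2) :
    opA μ γ (WithLp.toLp 2 (f, g)) - z • WithLp.toLp 2 (f, g) =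
      WithLp.toLp 2 (mulOp _ (memLp_w1 γ) f + (μ : ℂ) • A12 g - z • f,
        (μ : ℂ) • ContinuousLinearMap.adjoint A12 f +
          symMulOp (fun x => (w2 x.1 x.2 : ℂ)) memLp_w2
            (fun x => congrArg Complex.ofReal (w2_comm x.2 x.1)) g - z • g) := rfl

/-- The pointwise form of the second component of `(𝒜_μ - z)(f, g)`. -/
lemma snd_opA_sub_apply (μ γ : ℝ) (z : ℂ) (f : H1) (g : H2) :
    (opA μ γ (WithLp.toLp 2 (f, g)) - z • WithLp.toLp 2 (f, g)).snd.1
      =ᵐ[(volume : Measure T3).prod volume]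
      fun x => μ * ((f x.1 + f x.2) / 2) + (w2 x.1 x.2 - z) * g.1 x := by
  rw [opA_sub_smul]
  change ((((μ : ℂ) • (ContinuousLinearMap.adjoint A12 f).1 + mulOp _ memLp_w2 g.1 -
    z • g.1 : Lp ℂ 2 ((volume : Measure T3).prod (volume : Measure T3)))) : T3 × T3 → ℂ) =ᵐ[_] _
  filter_upwards [Lp.coeFn_sub ((μ : ℂ) • (ContinuousLinearMap.adjoint A12 f).1 +
      mulOp _ memLp_w2 g.1) (z • g.1), Lp.coeFn_add ((μ : ℂ) •
      (ContinuousLinearMap.adjoint A12 f).1) (mulOp _ memLp_w2 g.1), Lp.coeFn_smul z g.1,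
    Lp.coeFn_smul (μ : ℂ) (ContinuousLinearMap.adjoint A12 f).1, mulOp_apply _ memLp_w2 g.1,
    adjoint_A12_apply f] with x h1 h2 h3 h4 h5 h6
  rw [h1, Pi.sub_apply, h2, Pi.add_apply, h3, Pi.smul_apply, h4, Pi.smul_apply, h5, h6,
    smul_eq_mul, smul_eq_mul]
  ring

/-- The Schur complement of `𝒜_μ - z` with respect to its second diagonal entry. -/
lemma mulOp_fredDet_eq (μ γ : ℝ) {z : ℝ} (hz : z ∉ Icc (0 : ℝ) 18) (f : H1) (g : H2) :
    mulOp _ (memLp_fredDet μ γ hz) f =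
      (opA μ γ (WithLp.toLp 2 (f, g)) - (z : ℂ) • WithLp.toLp 2 (f, g)).fst -
      (μ : ℂ) • integrateSnd volume (mulOp _ (memLp_resKer hz)
        (opA μ γ (WithLp.toLp 2 (f, g)) - (z : ℂ) • WithLp.toLp 2 (f, g)).snd.1) +
      ((μ : ℂ) ^ 2 / 2) • kerOp _ (memLp_resKer hz) f := by
  have hV := snd_opA_sub_apply μ γ z f g
  set V := (opA μ γ (WithLp.toLp 2 (f, g)) - (z : ℂ) • WithLp.toLp 2 (f, g)).snd.1
  have hU : (opA μ γ (WithLp.toLp 2 (f, g)) - (z : ℂ) • WithLp.toLp 2 (f, g)).fst =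
      mulOp _ (memLp_w1 γ) f + (μ : ℂ) • A12 g - (z : ℂ) • f := rfl
  rw [hU]
  set W := mulOp _ (memLp_resKer hz) V with hW
  set K := kerOp _ (memLp_resKer hz) f with hK
  have hfi : Integrable (f : T3 → ℂ) := (Lp.memLp f).integrable (by norm_num)
  obtain ⟨C, -, hC⟩ := exists_norm_resKer_le hz
  refine Lp.ext ?_
  filter_upwards [mulOp_apply _ (memLp_fredDet μ γ hz) f,
    Lp.coeFn_add (mulOp _ (memLp_w1 γ) f + (μ : ℂ) • A12 g - (z : ℂ) • f -
      (μ : ℂ) • integrateSnd volume W) (((μ : ℂ) ^ 2 / 2) • K),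
    Lp.coeFn_sub (mulOp _ (memLp_w1 γ) f + (μ : ℂ) • A12 g - (z : ℂ) • f)
      ((μ : ℂ) • integrateSnd volume W),
    Lp.coeFn_sub (mulOp _ (memLp_w1 γ) f + (μ : ℂ) • A12 g) ((z : ℂ) • f),
    Lp.coeFn_add (mulOp _ (memLp_w1 γ) f) ((μ : ℂ) • A12 g), Lp.coeFn_smul ((μ : ℂ) ^ 2 / 2) K,
    Lp.coeFn_smul (μ : ℂ) (integrateSnd volume W), Lp.coeFn_smul (z : ℂ) f,
    Lp.coeFn_smul (μ : ℂ) (A12 g), mulOp_apply _ (memLp_w1 γ) f, A12_apply g,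
    integrateSnd_apply W, kerOp_apply _ (memLp_resKer hz) f, Measure.ae_ae_of_ae_prod hV,
    Measure.ae_ae_of_ae_prod (mulOp_apply _ (memLp_resKer hz) V), integrable_section g.1]
    with k h1 h2 h3 h4 h5 h6 h7 h8 h9 h10 h11 h12 h13 h14 h15 h16
  have hint : Integrable (fun s => resKer z (k, s) * f s) :=
    hfi.bdd_mul (c := C) ((measurable_resKer z).comp measurable_prodMk_left).aestronglyMeasurable
      (Eventually.of_forall fun s => hC _)
  -- Divide the second component by w₂ - z and integrate over the second variable. The half of the
  -- adjoint carrying `f k` yields I(k; z), the half carrying `f s` yields the integral operator,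
  -- and the last term is the value of `A12 g`, which cancels against the first component.
  have hWk : ∫ s, W (k, s) = μ / 2 * f k * intI k z +
      μ / 2 * (∫ s, resKer z (k, s) * f s) + ∫ s, g.1 (k, s) := by
    have : ∫ s, W (k, s) = ∫ s, (μ / 2 * f k * resKer z (k, s) +
        μ / 2 * (resKer z (k, s) * f s) + g.1 (k, s)) := by
      refine integral_congr_ae ?_
      filter_upwards [h14, h15] with s a1 a2
      have hne : (w2 k s : ℂ) - z ≠ 0 := by exact_mod_cast w2_sub_ne_zero hz k s
      rw [a2, a1, resKer]
      push_cast
      field_simp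
    have i1 : Integrable fun s => μ / 2 * f k * resKer z (k, s) :=
      (integrable_resKer_section hz k).const_mul _
    have i2 : Integrable fun s => (μ : ℂ) / 2 * (resKer z (k, s) * f s) := hint.const_mul _
    have i3 : Integrable fun s => μ / 2 * f k * resKer z (k, s) +
      (μ : ℂ) / 2 * (resKer z (k, s) * f s) := i1.add i2
    rw [this, integral_add i3 h16, integral_add i1 i2, integral_const_mul, integral_const_mul, integral_resKer_section]
  rw [h1, h2, Pi.add_apply, h3, Pi.sub_apply, h4, Pi.sub_apply, h5, Pi.add_apply, h6,
    Pi.smul_apply, h7, Pi.smul_apply, h8, Pi.smul_apply, h9, Pi.smul_apply, h10, h11, h12, hWk,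
    h13]
  simp only [smul_eq_mul, fredDet]
  push_cast
  ring

/-- The second component is controlled by the image under `𝒜_μ - z` and the first one. -/
lemma norm_snd_le (μ γ : ℝ) {z C : ℝ} (hz : z ∉ Icc (0 : ℝ) 18)
    (hC : ∀ x, ‖resKer z x‖ ≤ C) (f : H1) (g : H2) :
    ‖g‖ ≤ C * ‖(opA μ γ (WithLp.toLp 2 (f, g)) - (z : ℂ) • WithLp.toLp 2 (f, g)).snd -
      (μ : ℂ) • ContinuousLinearMap.adjoint A12 f‖ := by
  have hV := snd_opA_sub_apply μ γ z f g
  set V := (opA μ γ (WithLp.toLp 2 (f, g)) - (z : ℂ) • WithLp.toLp 2 (f, g)).snd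
  have hg : g.1 = mulOp _ (memLp_resKer hz)
      (V.1 - (μ : ℂ) • (ContinuousLinearMap.adjoint A12 f).1) := by
    refine Lp.ext ?_
    filter_upwards [hV, mulOp_apply _ (memLp_resKer hz)
      (V.1 - (μ : ℂ) • (ContinuousLinearMap.adjoint A12 f).1),
      Lp.coeFn_sub V.1 ((μ : ℂ) • (ContinuousLinearMap.adjoint A12 f).1),
      Lp.coeFn_smul (μ : ℂ) (ContinuousLinearMap.adjoint A12 f).1, adjoint_A12_apply f]
      with x h1 h2 h3 h4 h5
    have hne : (w2 x.1 x.2 : ℂ) - z ≠ 0 := by exact_mod_cast w2_sub_ne_zero hz x.1 x.2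
    rw [h2, h3, Pi.sub_apply, h4, Pi.smul_apply, h5, h1, resKer, smul_eq_mul]
    push_cast
    field_simp
    ring
  calc ‖g‖ = ‖g.1‖ := rfl
    _ ≤ C * ‖V.1 - (μ : ℂ) • (ContinuousLinearMap.adjoint A12 f).1‖ := by
      conv_lhs => rw [hg]
      exact norm_mulOp_le _ _ (Eventually.of_forall fun x _ => hC x)

/-- Off `[0, 18]`, points where the Fredholm determinant stays away from zero do not belong to the
essential spectrum. -/
theorem notMem_essentialSpectrum_opA {μ γ z δ : ℝ} (hz : z ∉ Icc (0 : ℝ) 18) (hδ : 0 < δ)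
    (hΔ : ∀ k, δ ≤ |fredDet μ γ k z|) : (z : ℂ) ∉ essentialSpectrum (opA μ γ) := by
  intro hess
  obtain ⟨x, hx1, hxw, hxz⟩ :=
    exists_singular_sequence_of_mem_essentialSpectrum (isSelfAdjoint_opA μ γ) hess
  obtain ⟨C, hC0, hC⟩ := exists_norm_resKer_le hz
  have hU := tendsto_fst_of_tendsto hxz
  have hV := tendsto_snd_of_tendsto hxz
  have hfw := weakly_null_fst hxw
  have hfM : ∀ n, ‖(x n).fst‖ ≤ 1 := fun n => by
    have h := WithLp.prod_norm_sq_eq_of_L2 (x n)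
    rw [hx1] at h
    refine le_of_sq_le_sq ?_ zero_le_one
    rw [h]
    exact le_add_of_nonneg_right (sq_nonneg _)
  -- Complete continuity removes the integral operator from the Schur identity. What is left says
  -- that Δ times the first components tends to zero; these then tend to zero, the second components
  -- follow, and unit norm is contradicted.
  have hK := tendsto_kerOp (memLp_resKer hz) (measurable_resKer z) hC hfM hfw
  have hVW : Tendsto (fun n => integrateSnd volume (mulOp _ (memLp_resKer hz)
      (opA μ γ (x n) - (z : ℂ) • x n).snd.1)) atTop (𝓝 0) := by
    have hcont : Continuous fun V : H2 => integrateSnd volume (mulOp _ (memLp_resKer hz) V.1) :=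
      (integrateSnd volume).continuous.comp
        ((mulOp _ (memLp_resKer hz)).continuous.comp continuous_subtype_val)
    exact (hcont.tendsto' 0 0 (by simp)).comp hV
  have hD : Tendsto (fun n => mulOp _ (memLp_fredDet μ γ hz) (x n).fst) atTop (𝓝 0) := by
    have h := (hU.sub (hVW.const_smul (μ : ℂ))).add (hK.const_smul ((μ : ℂ) ^ 2 / 2))
    simp only [smul_zero, sub_zero, add_zero] at h
    exact h.congr fun n => (mulOp_fredDet_eq μ γ hz (x n).fst (x n).snd).symm
  have hf : Tendsto (fun n => (x n).fst) atTop (𝓝 0) := by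
    refine squeeze_zero_norm (a := fun n => δ⁻¹ * ‖mulOp _ (memLp_fredDet μ γ hz) (x n).fst‖)
      (fun n => ?_) (by simpa using hD.norm.const_mul δ⁻¹)
    rw [le_inv_mul_iff₀ hδ]
    refine le_norm_mulOp _ _ hδ fun k => ?_
    rw [Complex.norm_real]
    exact hΔ k
  have hg : Tendsto (fun n => (x n).snd) atTop (𝓝 0) := by
    refine squeeze_zero_norm (fun n => norm_snd_le μ γ hz hC (x n).fst (x n).snd) ?_
    have h1 := ((ContinuousLinearMap.adjoint A12).continuous.tendsto 0).comp hf
    rw [map_zero] at h1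
    have h2 := (hV.sub (h1.const_smul (μ : ℂ))).norm.const_mul C
    simp only [smul_zero, sub_zero, norm_zero, mul_zero] at h2
    exact h2
  have h0 := (tendsto_toLp_prod hf hg).norm
  have h1 : ∀ n, ‖WithLp.toLp 2 ((x n).fst, (x n).snd)‖ = 1 := hx1
  simp only [h1, norm_zero] at h0
  exact one_ne_zero (tendsto_nhds_unique tendsto_const_nhds h0)

/-- Off `[0, 18]`, singular sequences for the Fredholm determinant give points of the essential
spectrum. -/
theorem mem_essentialSpectrum_opA {μ γ z : ℝ} (hz : z ∉ Icc (0 : ℝ) 18) {f : ℕ → H1}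
    (hf1 : ∀ n, ‖f n‖ = 1) (hfw : ∀ y, Tendsto (fun n => inner ℂ y (f n)) atTop (𝓝 0))
    (hfΔ : Tendsto (fun n => mulOp _ (memLp_fredDet μ γ hz) (f n)) atTop (𝓝 0)) :
    (z : ℂ) ∈ essentialSpectrum (opA μ γ) := by
  obtain ⟨C, hC0, hC⟩ := exists_norm_resKer_le hz
  let R : H2 →L[ℂ] H2 := symMulOp _ (memLp_resKer hz) (resKer_swap z)
  -- `G f` is the exact solution g of the second component with V = 0, so only the Schur complement
  -- remains in the first.
  let G : H1 →L[ℂ] H2 := (-(μ : ℂ)) • (R ∘L ContinuousLinearMap.adjoint A12)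
  have hV : ∀ f, (opA μ γ (WithLp.toLp 2 (f, G f)) - (z : ℂ) • WithLp.toLp 2 (f, G f)).snd.1
      = 0 := by
    intro f
    refine Lp.ext ?_
    have hG : (G f).1 = (-(μ : ℂ)) • mulOp _ (memLp_resKer hz)
      (ContinuousLinearMap.adjoint A12 f).1 := rfl
    filter_upwards [snd_opA_sub_apply μ γ z f (G f), Lp.coeFn_zero ℂ 2
      ((volume : Measure T3).prod (volume : Measure T3)), Lp.coeFn_smul (-(μ : ℂ))
      (mulOp _ (memLp_resKer hz) (ContinuousLinearMap.adjoint A12 f).1),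
      mulOp_apply _ (memLp_resKer hz) (ContinuousLinearMap.adjoint A12 f).1,
      adjoint_A12_apply f] with x h1 h2 h3 h4 h5
    have hne : (w2 x.1 x.2 : ℂ) - z ≠ 0 := by exact_mod_cast w2_sub_ne_zero hz x.1 x.2
    rw [h1, h2, hG, h3, Pi.smul_apply, h4, h5, resKer, smul_eq_mul, Pi.zero_apply]
    push_cast
    field_simp
    ring
  have hK := tendsto_kerOp (memLp_resKer hz) (measurable_resKer z) hC (fun n => (hf1 n).le) hfw
  refine mem_essentialSpectrum_of_singular_sequence (isSelfAdjoint_opA μ γ)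
    (x := fun n => WithLp.toLp 2 (f n, G (f n))) (fun n => ?_)
    (weakly_null_toLp_prod hfw (weakly_null_map hfw G)) ?_
  -- The pairs need no renormalization: the criterion asks only for norms at least 1, which the
  -- first component already provides.
  · have h := WithLp.prod_norm_sq_eq_of_L2 (WithLp.toLp 2 (f n, G (f n)))
    refine le_of_sq_le_sq ?_ (norm_nonneg _)
    rw [h]
    change 1 ^ 2 ≤ ‖f n‖ ^ 2 + ‖G (f n)‖ ^ 2
    rw [hf1]
    exact le_add_of_nonneg_right (sq_nonneg _)
  · have hU : Tendsto (fun n => (opA μ γ (WithLp.toLp 2 (f n, G (f n))) -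
        (z : ℂ) • WithLp.toLp 2 (f n, G (f n))).fst) atTop (𝓝 0) := by
      have h := hfΔ.sub (hK.const_smul ((μ : ℂ) ^ 2 / 2))
      simp only [smul_zero, sub_zero] at h
      refine h.congr fun n => ?_
      rw [mulOp_fredDet_eq μ γ hz (f n) (G (f n)), hV]
      simp
    have hV' : ∀ n, (opA μ γ (WithLp.toLp 2 (f n, G (f n))) -
        (z : ℂ) • WithLp.toLp 2 (f n, G (f n))).snd = 0 := fun n => Subtype.ext (hV (f n))
    refine (tendsto_toLp_prod hU (y := fun _ => (0 : H2)) tendsto_const_nhds).congr fun n => ?_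
    rw [← hV' n]
    rfl

/-! ### The generalized Friedrichs model -/

lemma friedrichs_sub_smul (μ γ : ℝ) (k : T3) (z a : ℂ) (f : H1) :
    friedrichs μ γ k (WithLp.toLp 2 (a, f)) - z • WithLp.toLp 2 (a, f) =
      WithLp.toLp 2 (w1 γ k * a + ((μ / √2 : ℝ) : ℂ) * integralFunctional volume f - z * a,
        ((μ / √2 : ℝ) : ℂ) • ContinuousLinearMap.adjoint (integralFunctional volume) a +
          mulOp _ (memLp_w2_section k) f - z • f) := rfl

lemma snd_friedrichs_sub_apply (μ γ : ℝ) (k : T3) (z a : ℂ) (f : H1) :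
    (friedrichs μ γ k (WithLp.toLp 2 (a, f)) - z • WithLp.toLp 2 (a, f)).snd =ᵐ[volume]
      fun p => ((μ / √2 : ℝ) : ℂ) * a + (w2 k p - z) * f p := by
  rw [friedrichs_sub_smul]
  change ((((μ / √2 : ℝ) : ℂ) • ContinuousLinearMap.adjoint (integralFunctional volume) a +
    mulOp _ (memLp_w2_section k) f - z • f : H1) : T3 → ℂ) =ᵐ[_] _
  filter_upwards [Lp.coeFn_sub (((μ / √2 : ℝ) : ℂ) • ContinuousLinearMap.adjoint
      (integralFunctional (volume : Measure T3)) a + mulOp _ (memLp_w2_section k) f) (z • f),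
    Lp.coeFn_add (((μ / √2 : ℝ) : ℂ) • ContinuousLinearMap.adjoint
      (integralFunctional (volume : Measure T3)) a) (mulOp _ (memLp_w2_section k) f),
    Lp.coeFn_smul z f, Lp.coeFn_smul ((μ / √2 : ℝ) : ℂ) (ContinuousLinearMap.adjoint
      (integralFunctional (volume : Measure T3)) a), mulOp_apply _ (memLp_w2_section k) f,
    adjoint_integralFunctional_apply (ν := (volume : Measure T3)) a] with x h1 h2 h3 h4 h5 h6
  rw [h1, Pi.sub_apply, h2, Pi.add_apply, h3, Pi.smul_apply, h4, Pi.smul_apply, h5, h6,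
    smul_eq_mul, smul_eq_mul]
  ring

lemma mul_self_div_sqrt_two (μ : ℝ) :
    ((μ / √2 : ℝ) : ℂ) * ((μ / √2 : ℝ) : ℂ) = (μ : ℂ) ^ 2 / 2 := by
  have : (μ / √2) * (μ / √2) = μ ^ 2 / 2 := by
    rw [div_mul_div_comm, Real.mul_self_sqrt (by norm_num), sq]
  exact_mod_cast congrArg Complex.ofReal this

/-- The second component forces f = -(μ/√2) a/(w₂ - z). Then a = 0 would annihilate the eigenvector,
so the first component can be divided by a and becomes Δ = 0. Nonvanishing almost everywhere is
enough, which admits z = 0 although w₂(0, 0) = 0. -/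
lemma fredDet_eq_zero_of_hasEigenvalue {μ γ z : ℝ} {k : T3} (hz : ∀ᵐ p, w2 k p - z ≠ 0)
    (h : Module.End.HasEigenvalue
      (friedrichs μ γ k : WithLp 2 (ℂ × H1) →ₗ[ℂ] WithLp 2 (ℂ × H1)) (z : ℂ)) :
    fredDet μ γ k z = 0 := by
  obtain ⟨x, hx⟩ := h.exists_hasEigenvector
  have h0 : friedrichs μ γ k (WithLp.toLp 2 (x.fst, x.snd)) -
      (z : ℂ) • WithLp.toLp 2 (x.fst, x.snd) = 0 := sub_eq_zero.2 hx.apply_eq_smul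
  have hsnd := snd_friedrichs_sub_apply μ γ k z x.fst x.snd
  have hfst := congrArg WithLp.fst h0
  rw [h0] at hsnd
  rw [friedrichs_sub_smul] at hfst
  replace hfst : w1 γ k * x.fst + ((μ / √2 : ℝ) : ℂ) * integralFunctional volume x.snd -
    z * x.fst = 0 := hfst
  have hf : ∀ᵐ p, x.snd p = -(((μ / √2 : ℝ) : ℂ) * x.fst) * resKer z (k, p) := by
    filter_upwards [hsnd, hz, Lp.coeFn_zero ℂ 2 (volume : Measure T3)] with p h1 h2 h3
    have hne : (w2 k p : ℂ) - z ≠ 0 := by exact_mod_cast h2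
    have h4 : ((μ / √2 : ℝ) : ℂ) * x.fst + (w2 k p - z) * x.snd p = 0 := h1.symm.trans h3
    rw [resKer]
    push_cast at h4 ⊢
    field_simp at h4 ⊢
    linear_combination h4
  rw [integralFunctional_apply, integral_congr_ae hf, integral_const_mul,
    integral_resKer_section] at hfst
  have hΔ : (fredDet μ γ k z : ℂ) * x.fst = 0 := by
    simp only [fredDet]
    push_cast
    linear_combination hfst + x.fst * intI k z * mul_self_div_sqrt_two μ
  rcases mul_eq_zero.1 hΔ with h1 | h1
  · exact_mod_cast h1
  · exfalso
    refine hx.2 ?_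
    have hs : x.snd = 0 := by
      refine Lp.ext ?_
      filter_upwards [hf, Lp.coeFn_zero ℂ 2 (volume : Measure T3)] with p h2 h3
      rw [h2, h3, h1]
      simp
    have : x = WithLp.toLp 2 (x.fst, x.snd) := rfl
    rw [this, h1, hs]
    rfl

/-- Along a singular sequence the scalar component tends to zero, weak and strong convergence being
the same in ℂ. The coupling then drops out, and multiplication by w₂(k, ·) - z, bounded below,
forces the other component to zero as well. -/
lemma notMem_essentialSpectrum_friedrichs (μ γ : ℝ) {z : ℝ} (k : T3) (hz : z ∉ Icc (0 : ℝ) 18) :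
    (z : ℂ) ∉ essentialSpectrum (friedrichs μ γ k) := by
  intro hess
  obtain ⟨x, hx1, hxw, hxz⟩ :=
    exists_singular_sequence_of_mem_essentialSpectrum (isSelfAdjoint_friedrichs μ γ k) hess
  obtain ⟨d, hd, hw⟩ := exists_le_abs_w2_sub hz
  have ha : Tendsto (fun n => (x n).fst) atTop (𝓝 0) := by
    simpa using weakly_null_fst hxw 1
  have hV := tendsto_snd_of_tendsto hxz
  have hg : Tendsto (fun n => (x n).snd) atTop (𝓝 0) := by
    have h1 := ((ContinuousLinearMap.adjoint
      (integralFunctional (volume : Measure T3))).continuous.tendsto 0).comp ha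
    rw [map_zero] at h1
    have h2 := (hV.sub (h1.const_smul ((μ / √2 : ℝ) : ℂ))).norm.const_mul d⁻¹
    simp only [smul_zero, sub_zero, norm_zero, mul_zero] at h2
    refine squeeze_zero_norm (fun n => ?_) h2
    rw [le_inv_mul_iff₀ hd]
    have hm : MemLp (fun p : T3 => ((w2 k p - z : ℝ) : ℂ)) ∞ volume := by
      refine (memLp_congr_ae (Eventually.of_forall fun p => ?_)).1
        ((memLp_w2_section k).sub (memLp_const (z : ℂ)))
      simp
    refine (le_norm_mulOp hm _ hd fun p => by rw [Complex.norm_real]; exact hw k p).trans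
      (le_of_eq (congrArg norm ?_))
    refine Lp.ext ?_
    filter_upwards [snd_friedrichs_sub_apply μ γ k z (x n).fst (x n).snd, mulOp_apply _ hm (x n).snd,
      Lp.coeFn_sub (friedrichs μ γ k (x n) - (z : ℂ) • x n).snd (((μ / √2 : ℝ) : ℂ) •
        ContinuousLinearMap.adjoint (integralFunctional (volume : Measure T3)) (x n).fst),
      Lp.coeFn_smul ((μ / √2 : ℝ) : ℂ) (ContinuousLinearMap.adjoint
        (integralFunctional (volume : Measure T3)) (x n).fst),
      adjoint_integralFunctional_apply (ν := (volume : Measure T3)) (x n).fst]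
      with p h1 h2 h3 h4 h5
    rw [h2]
    refine Eq.trans ?_ h3.symm
    rw [Pi.sub_apply, h4, Pi.smul_apply, h5, smul_eq_mul]
    refine Eq.trans ?_ (congrArg (fun t => t - _) h1.symm)
    push_cast
    ring
  have h0 := (tendsto_toLp_prod ha hg).norm
  have h1 : ∀ n, ‖WithLp.toLp 2 ((x n).fst, (x n).snd)‖ = 1 := hx1
  simp only [h1, norm_zero] at h0
  exact one_ne_zero (tendsto_nhds_unique tendsto_const_nhds h0)

/-- Off `[0, 18]`, the zeros of the Fredholm determinant are discrete eigenvalues. -/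
lemma mem_discreteSpectrum_friedrichs {μ γ z : ℝ} {k : T3} (hz : z ∉ Icc (0 : ℝ) 18)
    (h : fredDet μ γ k z = 0) : (z : ℂ) ∈ discreteSpectrum (friedrichs μ γ k) := by
  obtain ⟨C, -, hC⟩ := exists_norm_resKer_le hz
  have hm : MemLp (fun p => -((μ / √2 : ℝ) : ℂ) * resKer z (k, p)) 2 (volume : Measure T3) := by
    refine MemLp.const_mul (MemLp.of_bound ?_ C (Eventually.of_forall fun s => hC _)) _
    exact ((measurable_resKer z).comp measurable_prodMk_left).aestronglyMeasurable
  have h0 : friedrichs μ γ k (WithLp.toLp 2 (1, hm.toLp _)) -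
      (z : ℂ) • WithLp.toLp 2 (1, hm.toLp _) = 0 := by
    have e1 : (friedrichs μ γ k (WithLp.toLp 2 (1, hm.toLp _)) -
      (z : ℂ) • WithLp.toLp 2 (1, hm.toLp _)).fst = 0 := by
      rw [friedrichs_sub_smul]
      change w1 γ k * 1 + ((μ / √2 : ℝ) : ℂ) * integralFunctional volume (hm.toLp _) -
        (z : ℂ) * 1 = 0
      rw [integralFunctional_apply, integral_congr_ae hm.coeFn_toLp, integral_const_mul,
        integral_resKer_section]
      have h' := congrArg Complex.ofReal h
      simp only [fredDet] at h'
      push_cast at h'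
      linear_combination h' - intI k z * mul_self_div_sqrt_two μ
    have e2 : (friedrichs μ γ k (WithLp.toLp 2 (1, hm.toLp _)) -
      (z : ℂ) • WithLp.toLp 2 (1, hm.toLp _)).snd = 0 := by
      refine Lp.ext ?_
      filter_upwards [snd_friedrichs_sub_apply μ γ k z 1 (hm.toLp _), hm.coeFn_toLp,
        Lp.coeFn_zero ℂ 2 (volume : Measure T3)] with p h1 h2 h3
      have hne : (w2 k p : ℂ) - z ≠ 0 := by exact_mod_cast w2_sub_ne_zero hz k p
      rw [h1, h2, h3, resKer, Pi.zero_apply]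
      push_cast
      field_simp
      ring
    have e3 : ∀ y : WithLp 2 (ℂ × H1), y = WithLp.toLp 2 (y.fst, y.snd) := fun _ => rfl
    rw [e3 (friedrichs μ γ k _ - _), e1, e2]
    rfl
  have hev : Module.End.HasEigenvalue
      (friedrichs μ γ k : WithLp 2 (ℂ × H1) →ₗ[ℂ] WithLp 2 (ℂ × H1)) (z : ℂ) := by
    refine Module.End.hasEigenvalue_of_hasEigenvector (x := WithLp.toLp 2 (1, hm.toLp _))
      ⟨Module.End.mem_eigenspace_iff.2 (sub_eq_zero.1 h0), fun hx => ?_⟩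
    exact one_ne_zero (congrArg WithLp.fst hx)
  by_contra hd
  -- The eigenvalue lies in the spectrum; if it were not discrete it would be essential, which is
  -- excluded off [0, 18].
  refine notMem_essentialSpectrum_friedrichs μ γ k hz ⟨?_, hd⟩
  rw [mem_spectrum_iff_not_isUnit_sub]
  intro hu
  obtain ⟨D, hD⟩ := exists_le_norm_of_isUnit hu
  obtain ⟨x, hx⟩ := hev.exists_hasEigenvector
  have h1 := hD x
  have h2 : friedrichs μ γ k x = (z : ℂ) • x := hx.apply_eq_smul
  have h3 : (friedrichs μ γ k - (z : ℂ) • (1 : WithLp 2 (ℂ × H1) →L[ℂ] WithLp 2 (ℂ × H1))) x = 0 :=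
    sub_eq_zero.2 h2
  rw [h3, norm_zero, mul_zero, norm_le_zero_iff] at h1
  exact hx.2 h1

/-! ### Representatives in the cube -/

/-- The closed cube `[-π, π]³`. -/
def cube : Set (Fin 3 → ℝ) := Set.pi univ fun _ => Icc (-π) π

lemma measurableSet_cube : MeasurableSet cube :=
  MeasurableSet.univ_pi fun _ => measurableSet_Icc

/-- The half-open cube of representatives is replaced by the closed one, which differs by null faces
and is invariant under reflections of the coordinates. -/
lemma measurePreserving_rep :
    MeasurePreserving rep (volume : Measure T3) ((volume : Measure (Fin 3 → ℝ)).restrict cube) := by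
  have h1 : MeasurePreserving
      (fun θ : AddCircle (2 * π) => (AddCircle.equivIoc (2 * π) (-π) θ : ℝ)) volume
      ((volume : Measure ℝ).restrict (Icc (-π) π)) := by
    have h := (measurePreserving_subtype_coe (μa := (volume : Measure ℝ))
      (s := Ioc (-π) (-π + 2 * π)) measurableSet_Ioc).comp
      (AddCircle.measurePreserving_equivIoc (2 * π) (a := -π))
    have hI : Ioc (-π) (-π + 2 * π) = Ioc (-π) π := by congr 1; ring
    rw [Measure.restrict_congr_set (Ioc_ae_eq_Icc (a := -π) (b := π)).symm, ← hI]
    exact h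
  have h2 := measurePreserving_pi (fun _ : Fin 3 => (volume : Measure (AddCircle (2 * π))))
    (fun _ : Fin 3 => (volume : Measure ℝ).restrict (Icc (-π) π)) (fun _ => h1)
  rw [← Measure.restrict_pi_pi] at h2
  exact h2

lemma rep_mem (k : T3) (i : Fin 3) : rep k i ∈ Ioc (-π) π := by
  have h := (AddCircle.equivIoc (2 * π) (-π) (k i)).2
  exact ⟨h.1, h.2.trans (by linarith)⟩

lemma rep_mem_cube (k : T3) : rep k ∈ cube := fun i _ => Ioc_subset_Icc_self (rep_mem k i)

lemma rep_coe {q : Fin 3 → ℝ} (hq : ∀ i, q i ∈ Ioc (-π) π) :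
    rep (fun i => (q i : AddCircle (2 * π))) = q := by
  funext i
  have h : q i ∈ Ioc (-π) (-π + 2 * π) := by
    rw [show -π + 2 * π = π by ring]
    exact hq i
  exact congrArg Subtype.val (AddCircle.equivIoc_coe_eq h)

/-- The point `a` may lie on a face of the cube, as it does for z = 18 in
`Icc_subset_essentialSpectrum`. Positivity holds because the open cube is dense in the closed one.
-/
lemma measure_preimage_rep_pos {U : Set (Fin 3 → ℝ)} (hU : IsOpen U) {a : Fin 3 → ℝ}
    (haU : a ∈ U) (ha : a ∈ cube) : 0 < volume (rep ⁻¹' U) := by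
  rw [measurePreserving_rep.measure_preimage hU.measurableSet.nullMeasurableSet,
    Measure.restrict_apply hU.measurableSet]
  have hcl : a ∈ closure (Set.pi univ fun _ : Fin 3 => Ioo (-π) π) := by
    rw [closure_pi_set]
    intro i hi
    rw [closure_Ioo (by linarith [Real.pi_pos])]
    exact ha i hi
  have hne : (U ∩ Set.pi univ fun _ : Fin 3 => Ioo (-π) π).Nonempty :=
    mem_closure_iff.1 hcl U hU haU
  refine lt_of_lt_of_le ((hU.inter (isOpen_set_pi finite_univ
    fun _ _ => isOpen_Ioo)).measure_pos volume hne) (measure_mono ?_)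
  exact inter_subset_inter_right _ (Set.pi_mono fun _ _ => Ioo_subset_Icc_self)

lemma exists_shrinking_balls {P : ℕ → Set (Fin 3 → ℝ)} {a : Fin 3 → ℝ}
    (hP : ∀ n, P n ∈ 𝓝 a) : ∃ U : ℕ → Set (Fin 3 → ℝ), (∀ n, IsOpen (U n)) ∧ (∀ n, a ∈ U n) ∧
      (∀ n, U n ⊆ P n) ∧ Tendsto (fun n => volume (rep ⁻¹' U n)) atTop (𝓝 0) := by
  choose r hr hrP using fun n => Metric.mem_nhds_iff.1 (hP n)
  refine ⟨fun n => Metric.ball a (min (r n) (1 / ((n : ℝ) + 1))), fun n => Metric.isOpen_ball,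
    fun n => Metric.mem_ball_self (lt_min (hr n) (by positivity)),
    fun n => (Metric.ball_subset_ball (min_le_left _ _)).trans (hrP n), ?_⟩
  have hlim : Tendsto (fun n : ℕ => ENNReal.ofReal ((2 * (1 / ((n : ℝ) + 1))) ^ 3)) atTop (𝓝 0) := by
    have h := ((tendsto_one_div_add_atTop_nhds_zero_nat (𝕜 := ℝ)).const_mul 2).pow 3
    simpa using ENNReal.tendsto_ofReal h
  refine tendsto_of_tendsto_of_tendsto_of_le_of_le tendsto_const_nhds hlim (fun n => zero_le) ?_
  intro n
  dsimp only
  rw [measurePreserving_rep.measure_preimage Metric.isOpen_ball.measurableSet.nullMeasurableSet]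
  refine (Measure.restrict_apply_le _ _).trans ((measure_mono (Metric.ball_subset_ball
    (min_le_right _ _))).trans (le_of_eq ?_))
  rw [Real.volume_pi_ball _ (by positivity), Fintype.card_fin]

/-! ### Singular sequences of normalized indicators -/

section Indicators

variable {X : Type*} [MeasurableSpace X] {ν : Measure X}

/-- Pairing with `y` only sees the restriction of `y` to `S n`, whose L₂ norm tends to zero by
absolute continuity of the integral. -/
lemma weakly_null_of_shrinking_support {f : ℕ → Lp ℂ 2 ν} (hf : ∀ n, ‖f n‖ ≤ 1) {S : ℕ → Set X}
    (hS : ∀ n, MeasurableSet (S n)) (hfS : ∀ n, ∀ᵐ x ∂ν, x ∉ S n → f n x = 0)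
    (hlim : Tendsto (fun n => ν (S n)) atTop (𝓝 0)) (y : Lp ℂ 2 ν) :
    Tendsto (fun n => inner ℂ y (f n)) atTop (𝓝 0) := by
  have hm : ∀ n, MemLp ((S n).indicator fun _ => (1 : ℂ)) ∞ ν := fun n =>
    memLp_top_of_bound ((measurable_const.indicator (hS n)).aestronglyMeasurable) 1
      (Eventually.of_forall fun x => (norm_indicator_le_norm_self _ _).trans (by simp))
  have hy : Tendsto (fun n => ‖mulOp _ (hm n) y‖ ^ 2) atTop (𝓝 0) := by
    have h1 : ∀ n, ‖mulOp _ (hm n) y‖ ^ 2 = ∫ x in S n, ‖y x‖ ^ 2 ∂ν := fun n => by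
      rw [norm_sq_eq_integral, ← integral_indicator (hS n)]
      refine integral_congr_ae ?_
      filter_upwards [mulOp_apply _ (hm n) y] with x hx
      rw [hx]
      by_cases h : x ∈ S n <;> simp [h]
    simp_rw [h1]
    exact Integrable.tendsto_setIntegral_nhds_zero ((Lp.memLp y).integrable_norm_pow (by norm_num))
      hlim
  have hy' : Tendsto (fun n => ‖mulOp _ (hm n) y‖) atTop (𝓝 0) := by
    simpa [Real.sqrt_sq (norm_nonneg _)] using hy.sqrt
  refine squeeze_zero_norm (fun n => ?_) hy'
  have h : inner ℂ y (f n) = inner ℂ (mulOp _ (hm n) y) (f n) := by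
    rw [L2.inner_def, L2.inner_def]
    refine integral_congr_ae ?_
    filter_upwards [mulOp_apply _ (hm n) y, hfS n] with x h1 h2
    rw [h1]
    by_cases hx : x ∈ S n
    · simp [hx]
    · simp [h2 hx]
  rw [h]
  exact (norm_inner_le_norm _ _).trans (mul_le_of_le_one_right (norm_nonneg _) (hf n))

/-- The indicator of `S` normalized in `L₂`. -/
def normIndicator [IsFiniteMeasure ν] {S : Set X} (hS : MeasurableSet S) : Lp ℂ 2 ν :=
  indicatorConstLp 2 hS (measure_ne_top ν S) (((√(ν.real S))⁻¹ : ℝ) : ℂ)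

lemma normIndicator_apply [IsFiniteMeasure ν] {S : Set X} (hS : MeasurableSet S) :
    normIndicator (ν := ν) hS =ᵐ[ν] S.indicator fun _ => (((√(ν.real S))⁻¹ : ℝ) : ℂ) :=
  indicatorConstLp_coeFn

lemma norm_normIndicator [IsFiniteMeasure ν] {S : Set X} (hS : MeasurableSet S) (h0 : 0 < ν S) :
    ‖normIndicator (ν := ν) hS‖ = 1 := by
  have hpos : 0 < ν.real S := ENNReal.toReal_pos h0.ne' (measure_ne_top ν S)
  rw [normIndicator, norm_indicatorConstLp (by norm_num) (by norm_num), Complex.norm_real,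
    norm_inv, Real.norm_eq_abs, abs_of_nonneg (Real.sqrt_nonneg _), ENNReal.toReal_ofNat,
    ← Real.sqrt_eq_rpow, inv_mul_cancel₀ (Real.sqrt_pos.2 hpos).ne']

end Indicators

/-- Off `[0, 18]`, zeros of a Fredholm determinant given by a continuous function of the
representative belong to the essential spectrum. -/
theorem mem_essentialSpectrum_opA_of_fredDet_eq_zero {μ γ z : ℝ} (hz : z ∉ Icc (0 : ℝ) 18)
    {F : (Fin 3 → ℝ) → ℝ} (hF : Continuous F) (hFΔ : ∀ k, fredDet μ γ k z = F (rep k)) {k₀ : T3}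
    (hk₀ : fredDet μ γ k₀ z = 0) : (z : ℂ) ∈ essentialSpectrum (opA μ γ) := by
  have hP : ∀ n : ℕ, {q | |F q| < 1 / ((n : ℝ) + 1)} ∈ 𝓝 (rep k₀) := fun n => by
    refine (isOpen_lt (hF.abs) continuous_const).mem_nhds ?_
    simp only [mem_ofPred_eq]
    rw [← hFΔ, hk₀, abs_zero]
    positivity
  obtain ⟨U, hUo, hUa, hUP, hU0⟩ := exists_shrinking_balls hP
  have hm : ∀ n, MeasurableSet (rep ⁻¹' U n) := fun n => measurable_rep (hUo n).measurableSet
  have hsupp : ∀ n, ∀ᵐ k ∂(volume : Measure T3), k ∉ rep ⁻¹' U n →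
      normIndicator (ν := (volume : Measure T3)) (hm n) k = 0 := fun n => by
    filter_upwards [normIndicator_apply (ν := (volume : Measure T3)) (hm n)] with k hk hkU
    rw [hk, indicator_of_notMem hkU]
  have h1 : ∀ n, ‖normIndicator (ν := (volume : Measure T3)) (hm n)‖ = 1 := fun n =>
    norm_normIndicator _ (measure_preimage_rep_pos (hUo n) (hUa n) (rep_mem_cube k₀))
  refine mem_essentialSpectrum_opA hz h1
    (weakly_null_of_shrinking_support (fun n => (h1 n).le) hm hsupp hU0) ?_
  refine squeeze_zero_norm (fun n => ?_) (tendsto_one_div_add_atTop_nhds_zero_nat (𝕜 := ℝ))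
  refine (norm_mulOp_le _ _ (c := 1 / ((n : ℝ) + 1)) ?_).trans (by rw [h1, mul_one])
  filter_upwards [hsupp n] with k hk hk0
  rw [Complex.norm_real, Real.norm_eq_abs, hFΔ]
  have hkU : k ∈ rep ⁻¹' U n := by
    by_contra h
    exact hk0 (hk h)
  exact (hUP n hkU).le

/-- The function `(q, q') ↦ ε(q) + ε((q + q')/2) + ε(q')` on `ℝ³ × ℝ³`. -/
def dispSum (q x : Fin 3 → ℝ) : ℝ := disp q + disp ((1 / 2 : ℝ) • (q + x)) + disp x

lemma w2_eq_dispSum (k p : T3) : w2 k p = dispSum (rep k) (rep p) := rfl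

lemma continuous_dispSum : Continuous fun x : (Fin 3 → ℝ) × (Fin 3 → ℝ) => dispSum x.1 x.2 := by
  unfold dispSum
  exact ((continuous_disp.comp continuous_fst).add (continuous_disp.comp (by fun_prop))).add
    (continuous_disp.comp continuous_snd)

/-- On the diagonal w₂(a, a) = 3ε(a). With all three coordinates equal to arccos(1 - z/9) this is
9(1 - cos) = z. Normalized indicators of S × S, with S shrinking to a, are symmetric and nearly
solve the second component, and their images under A₁₂ vanish in the limit. -/
theorem Icc_subset_essentialSpectrum (μ γ : ℝ) {z : ℝ} (hz : z ∈ Icc (0 : ℝ) 18) :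
    (z : ℂ) ∈ essentialSpectrum (opA μ γ) := by
  set a : Fin 3 → ℝ := fun _ => Real.arccos (1 - z / 9) with ha
  have hcos : Real.cos (Real.arccos (1 - z / 9)) = 1 - z / 9 :=
    Real.cos_arccos (by linarith [hz.2]) (by linarith [hz.1])
  have hdisp : disp a = z / 3 := by
    simp only [disp, ha, hcos, Fin.sum_univ_three]
    ring
  have haa : dispSum a a = z := by
    have : (1 / 2 : ℝ) • (a + a) = a := by
      ext i
      simp only [Pi.smul_apply, Pi.add_apply, smul_eq_mul]
      ring
    rw [dispSum, this, hdisp]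
    ring
  have hac : a ∈ cube := fun i _ =>
    ⟨by linarith [Real.arccos_nonneg (1 - z / 9), Real.pi_pos], Real.arccos_le_pi _⟩
  have hP : ∀ n : ℕ, ∃ P ∈ 𝓝 a, ∀ q ∈ P, ∀ q' ∈ P, |dispSum q q' - z| < 1 / ((n : ℝ) + 1) := by
    intro n
    have hopen : IsOpen {x : (Fin 3 → ℝ) × (Fin 3 → ℝ) |
        |dispSum x.1 x.2 - z| < 1 / ((n : ℝ) + 1)} :=
      isOpen_lt ((continuous_dispSum.sub continuous_const).abs) continuous_const
    have hmem := hopen.mem_nhds (x := (a, a)) (by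
      simp only [mem_ofPred_eq, haa, sub_self, abs_zero]
      positivity)
    rw [nhds_prod_eq, mem_prod_self_iff] at hmem
    obtain ⟨P, hP, hPP⟩ := hmem
    exact ⟨P, hP, fun q hq q' hq' => @hPP (q, q') ⟨hq, hq'⟩⟩
  choose P hP hPw using hP
  obtain ⟨U, hUo, hUa, hUP, hU0⟩ := exists_shrinking_balls hP
  set S : ℕ → Set T3 := fun n => rep ⁻¹' U n with hSdef
  have hm : ∀ n, MeasurableSet (S n) := fun n => measurable_rep (hUo n).measurableSet
  have hmm : ∀ n, MeasurableSet (S n ×ˢ S n) := fun n => (hm n).prod (hm n)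
  have hpos : ∀ n, 0 < volume (S n) := fun n => measure_preimage_rep_pos (hUo n) (hUa n) hac
  set ν2 := (volume : Measure T3).prod (volume : Measure T3) with hν2
  set g : ℕ → Lp ℂ 2 ν2 := fun n => normIndicator (hmm n) with hg
  have hgx : ∀ n, g n =ᵐ[ν2] (S n ×ˢ S n).indicator fun _ => (((√(ν2.real (S n ×ˢ S n)))⁻¹ : ℝ) : ℂ) :=
    fun n => normIndicator_apply (hmm n)
  have hsupp : ∀ n, ∀ᵐ x ∂ν2, x ∉ S n ×ˢ S n → g n x = 0 := fun n => by
    filter_upwards [hgx n] with x hx hxS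
    rw [hx, indicator_of_notMem hxS]
  have hreal : ∀ n, ν2.real (S n ×ˢ S n) = (volume (S n)).toReal * (volume (S n)).toReal :=
    fun n => by rw [Measure.real, hν2, Measure.prod_prod, ENNReal.toReal_mul]
  have h1 : ∀ n, ‖g n‖ = 1 := fun n => by
    refine norm_normIndicator _ ?_
    rw [hν2, Measure.prod_prod]
    exact ENNReal.mul_pos (hpos n).ne' (hpos n).ne'
  have hgs : ∀ n, g n ∈ symL2 (volume : Measure T3) := fun n => by
    rw [mem_symL2]
    filter_upwards [hgx n, (Measure.measurePreserving_swap (μ := (volume : Measure T3))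
      (ν := (volume : Measure T3))).quasiMeasurePreserving.ae (hgx n)] with x e1 e2
    rw [e1, e2]
    by_cases hx : x ∈ S n ×ˢ S n
    · rw [indicator_of_mem hx, indicator_of_mem (show x.swap ∈ S n ×ˢ S n from ⟨hx.2, hx.1⟩)]
    · rw [indicator_of_notMem hx, indicator_of_notMem fun h : x.swap ∈ S n ×ˢ S n => hx ⟨h.2, h.1⟩]
  -- The indicator of S × S is normalized by 1/|S|, and integrating out one variable gives back |S|.
  -- The result is the plain indicator of S, with norm √|S|.
  have hA12 : ∀ n, A12 ⟨g n, hgs n⟩ = indicatorConstLp 2 (hm n) (measure_ne_top volume _) (1 : ℂ) := by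
    intro n
    refine Lp.ext ?_
    filter_upwards [A12_apply ⟨g n, hgs n⟩, indicatorConstLp_coeFn (p := 2) (hs := hm n)
      (hμs := measure_ne_top (volume : Measure T3) _) (c := (1 : ℂ)),
      Measure.ae_ae_of_ae_prod (hgx n)] with k e1 e2 e3
    rw [e1, e2, integral_congr_ae e3]
    by_cases hk : k ∈ S n
    · have : ∀ s, (S n ×ˢ S n).indicator (fun _ => (((√(ν2.real (S n ×ˢ S n)))⁻¹ : ℝ) : ℂ)) (k, s) =
          (S n).indicator (fun _ => (((√(ν2.real (S n ×ˢ S n)))⁻¹ : ℝ) : ℂ)) s := fun s => by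
        by_cases hs : s ∈ S n <;> simp [hk, hs]
      have hp : 0 < (volume (S n)).toReal := ENNReal.toReal_pos (hpos n).ne' (measure_ne_top _ _)
      simp_rw [this]
      rw [integral_indicator (hm n), setIntegral_const, indicator_of_mem hk, hreal,
        Real.sqrt_mul_self hp.le, Measure.real, Complex.real_smul, ← Complex.ofReal_mul,
        mul_inv_cancel₀ hp.ne', Complex.ofReal_one]
    · simp [hk]
  have hA12lim : Tendsto (fun n => A12 ⟨g n, hgs n⟩) atTop (𝓝 0) := by
    rw [tendsto_zero_iff_norm_tendsto_zero]
    have hr : Tendsto (fun n => √((volume (S n)).toReal)) atTop (𝓝 0) := by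
      have := ((ENNReal.tendsto_toReal ENNReal.zero_ne_top).comp hU0).sqrt
      simpa using this
    refine hr.congr fun n => ?_
    rw [hA12, norm_indicatorConstLp (by norm_num) (by norm_num), norm_one, one_mul,
      ENNReal.toReal_ofNat, ← Real.sqrt_eq_rpow, Measure.real]
  have hS0 : Tendsto (fun n => ν2 (S n ×ˢ S n)) atTop (𝓝 0) := by
    have h := ENNReal.Tendsto.mul hU0 (Or.inr ENNReal.zero_ne_top) hU0
      (Or.inr ENNReal.zero_ne_top)
    rw [mul_zero] at h
    exact h.congr fun n => (Measure.prod_prod _ _).symm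
  have hgw := weakly_null_of_shrinking_support (fun n => (h1 n).le) hmm hsupp hS0
  have hsnd : Tendsto (fun n => (opA μ γ (WithLp.toLp 2 ((0 : H1), (⟨g n, hgs n⟩ : H2))) -
      (z : ℂ) • WithLp.toLp 2 ((0 : H1), (⟨g n, hgs n⟩ : H2))).snd) atTop (𝓝 0) := by
    refine squeeze_zero_norm (fun n => ?_) (tendsto_one_div_add_atTop_nhds_zero_nat (𝕜 := ℝ))
    have hone : 1 / ((n : ℝ) + 1) = 1 / ((n : ℝ) + 1) * ‖g n‖ := by rw [h1, mul_one]
    rw [hone]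
    change ‖(opA μ γ (WithLp.toLp 2 ((0 : H1), (⟨g n, hgs n⟩ : H2))) -
      (z : ℂ) • WithLp.toLp 2 ((0 : H1), (⟨g n, hgs n⟩ : H2))).snd.1‖ ≤ _
    refine Lp.norm_le_mul_norm_of_ae_le_mul ?_
    have hz1 := (Measure.quasiMeasurePreserving_fst (μ := (volume : Measure T3))
      (ν := (volume : Measure T3))).ae (Lp.coeFn_zero ℂ 2 (volume : Measure T3))
    have hz2 := (Measure.quasiMeasurePreserving_snd (μ := (volume : Measure T3))
      (ν := (volume : Measure T3))).ae (Lp.coeFn_zero ℂ 2 (volume : Measure T3))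
    filter_upwards [snd_opA_sub_apply μ γ z 0 ⟨g n, hgs n⟩, hsupp n, hz1, hz2] with x e1 e2 e3 e4
    rw [e1, e3, e4]
    simp only [Pi.zero_apply, add_zero, zero_div, mul_zero, zero_add]
    by_cases hx : x ∈ S n ×ˢ S n
    · rw [norm_mul, ← Complex.ofReal_sub, Complex.norm_real, Real.norm_eq_abs]
      exact mul_le_mul_of_nonneg_right
        (hPw n _ (hUP n hx.1) _ (hUP n hx.2)).le (norm_nonneg _)
    · rw [e2 hx]
      simp
  refine mem_essentialSpectrum_of_singular_sequence (isSelfAdjoint_opA μ γ)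
    (x := fun n => WithLp.toLp 2 ((0 : H1), (⟨g n, hgs n⟩ : H2))) (fun n => ?_)
    (weakly_null_toLp_prod (fun u => by simp) fun u => hgw u.1) ?_
  · have h := WithLp.prod_norm_sq_eq_of_L2 (WithLp.toLp 2 ((0 : H1), (⟨g n, hgs n⟩ : H2)))
    refine le_of_sq_le_sq ?_ (norm_nonneg _)
    rw [h]
    change 1 ^ 2 ≤ ‖(0 : H1)‖ ^ 2 + ‖g n‖ ^ 2
    rw [h1, norm_zero]
    norm_num
  · have hfst : Tendsto (fun n => (opA μ γ (WithLp.toLp 2 ((0 : H1), (⟨g n, hgs n⟩ : H2))) -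
        (z : ℂ) • WithLp.toLp 2 ((0 : H1), (⟨g n, hgs n⟩ : H2))).fst) atTop (𝓝 0) := by
      have h := hA12lim.const_smul (μ : ℂ)
      rw [smul_zero] at h
      refine h.congr fun n => ?_
      rw [opA_sub_smul]
      change _ = mulOp _ (memLp_w1 γ) 0 + (μ : ℂ) • A12 ⟨g n, hgs n⟩ - (z : ℂ) • (0 : H1)
      rw [map_zero, smul_zero, zero_add, sub_zero]
    exact tendsto_toLp_prod hfst hsnd

/-! ### Integrability of the inverse dispersion function -/

lemma disp_ge_of_mem_cube {x : Fin 3 → ℝ} (hx : x ∈ cube) :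
    2 / π ^ 2 * (x 0 ^ 2 + x 1 ^ 2 + x 2 ^ 2) ≤ disp x := by
  have h : ∀ i, 2 / π ^ 2 * x i ^ 2 ≤ 1 - Real.cos (x i) := fun i => by
    have := Real.cos_le_one_sub_mul_cos_sq (abs_le.2 (hx i (mem_univ i)))
    linarith
  rw [disp, Fin.sum_univ_three]
  linarith [h 0, h 1, h 2]

lemma ae_cube_ne_zero : ∀ᵐ x ∂(volume : Measure (Fin 3 → ℝ)).restrict cube, ∀ i, x i ≠ 0 :=
  ae_restrict_of_ae (ae_all_iff.2 fun i =>
    Measure.ae_eval_ne (fun _ : Fin 3 => (volume : Measure ℝ)) i 0)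

lemma disp_pos_of_mem_cube {x : Fin 3 → ℝ} (hx : x ∈ cube) (h0 : x 0 ≠ 0) : 0 < disp x := by
  refine lt_of_lt_of_le ?_ (disp_ge_of_mem_cube hx)
  have := Real.pi_pos
  positivity

lemma ae_cube_disp_pos : ∀ᵐ x ∂(volume : Measure (Fin 3 → ℝ)).restrict cube, 0 < disp x := by
  filter_upwards [ae_cube_ne_zero, ae_restrict_mem measurableSet_cube] with x h0 hx
  exact disp_pos_of_mem_cube hx (h0 0)

lemma integrableOn_abs_rpow {r a : ℝ} (hr : -1 < r) (ha : 0 ≤ a) :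
    IntegrableOn (fun t : ℝ => |t| ^ r) (Icc (-a) a) := by
  have h1 : IntervalIntegrable (fun t : ℝ => |t| ^ r) volume 0 a := by
    refine (intervalIntegral.intervalIntegrable_rpow' hr (a := 0) (b := a)).congr ?_
    intro t ht
    rw [uIoc_of_le ha] at ht
    simp only [abs_of_pos ht.1]
  have h2 : IntervalIntegrable (fun t : ℝ => |t| ^ r) volume (-a) 0 := by
    have h := (IntervalIntegrable.iff_comp_neg (f := fun t : ℝ => |t| ^ r)).1 h1
    simp only [abs_neg, neg_zero] at h
    exact h.symm
  have h3 := h2.trans h1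
  rw [intervalIntegrable_iff_integrableOn_Ioc_of_le (by linarith)] at h3
  exact (integrableOn_Icc_iff_integrableOn_Ioc (by simp)).2 h3

/-- On the cube ε(x) is at least a multiple of |x|². The inequality of means bounds |x|² below by
3∏|xᵢ|^(2/3), so 1/ε is dominated by a product of one-variable functions |xᵢ|^(-2/3), each
integrable since 2/3 < 1. -/
lemma integrable_inv_disp :
    Integrable (fun x => 1 / disp x) ((volume : Measure (Fin 3 → ℝ)).restrict cube) := by
  have hpi := Real.pi_pos
  have hprod : Integrable (fun x : Fin 3 → ℝ => ∏ i, |x i| ^ (-(2 / 3) : ℝ))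
      ((volume : Measure (Fin 3 → ℝ)).restrict cube) := by
    have h := Integrable.fintype_prod (ι := Fin 3) (f := fun _ (t : ℝ) => |t| ^ (-(2 / 3) : ℝ))
      (μ := fun _ => (volume : Measure ℝ).restrict (Icc (-π) π))
      (fun _ => integrableOn_abs_rpow (by norm_num) hpi.le)
    rw [← Measure.restrict_pi_pi] at h
    exact h
  refine Integrable.mono' (hprod.const_mul (π ^ 2 / 6))
    (continuous_disp.measurable.const_div 1).aestronglyMeasurable ?_
  filter_upwards [ae_cube_ne_zero, ae_restrict_mem measurableSet_cube] with x h0 hx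
  have hd := disp_pos_of_mem_cube hx (h0 0)
  have hlow := disp_ge_of_mem_cube hx
  have hp : ∀ i, 0 < |x i| := fun i => abs_pos.2 (h0 i)
  have hpow : ∀ i, (x i ^ 2) ^ (1 / 3 : ℝ) = |x i| ^ (2 / 3 : ℝ) := fun i => by
    rw [← sq_abs, ← Real.rpow_natCast, ← Real.rpow_mul (abs_nonneg _)]
    norm_num
  have ham := Real.geom_mean_le_arith_mean3_weighted (w₁ := 1 / 3) (w₂ := 1 / 3) (w₃ := 1 / 3)
    (by norm_num) (by norm_num) (by norm_num) (sq_nonneg (x 0)) (sq_nonneg (x 1))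
    (sq_nonneg (x 2)) (by norm_num)
  rw [hpow, hpow, hpow] at ham
  set P := |x 0| ^ (2 / 3 : ℝ) * |x 1| ^ (2 / 3 : ℝ) * |x 2| ^ (2 / 3 : ℝ) with hP
  have hPpos : 0 < P := by
    have := fun i => Real.rpow_pos_of_pos (hp i) (2 / 3)
    exact mul_pos (mul_pos (this 0) (this 1)) (this 2)
  have hPd : 6 / π ^ 2 * P ≤ disp x := by
    refine le_trans ?_ hlow
    have h := mul_le_mul_of_nonneg_left ham (show 0 ≤ 6 / π ^ 2 by positivity)
    refine h.trans (le_of_eq ?_)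
    ring
  have hprodP : ∏ i, |x i| ^ (-(2 / 3) : ℝ) = P⁻¹ := by
    rw [Fin.prod_univ_three, Real.rpow_neg (abs_nonneg _), Real.rpow_neg (abs_nonneg _),
      Real.rpow_neg (abs_nonneg _), hP, mul_inv, mul_inv]
  rw [Real.norm_eq_abs, abs_of_pos (by positivity), hprodP]
  calc 1 / disp x ≤ 1 / (6 / π ^ 2 * P) := one_div_le_one_div_of_le (by positivity) hPd
    _ = π ^ 2 / 6 * P⁻¹ := by field_simp

/-! ### The integral over the cube -/

lemma disp_le_dispSum (q x : Fin 3 → ℝ) : disp x ≤ dispSum q x :=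
  le_add_of_nonneg_left (add_nonneg (disp_nonneg _) (disp_nonneg _))

lemma measurable_one_div_dispSum_sub (q : Fin 3 → ℝ) (z : ℝ) :
    Measurable fun x => 1 / (dispSum q x - z) := by
  have h : Continuous fun x => dispSum q x := 
    Continuous.comp (f := fun x => (q, x)) continuous_dispSum (by fun_prop)
  exact (h.measurable.sub_const z).const_div 1

lemma norm_one_div_dispSum_sub_le {q x : Fin 3 → ℝ} {z : ℝ} (hz : z ≤ 0) (hx : 0 < disp x) :
    ‖1 / (dispSum q x - z)‖ ≤ 1 / disp x := by
  have h := disp_le_dispSum q x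
  rw [Real.norm_eq_abs, abs_of_nonneg (by apply one_div_nonneg.2; linarith)]
  exact one_div_le_one_div_of_le hx (by linarith)

lemma integrable_one_div_dispSum_sub (q : Fin 3 → ℝ) {z : ℝ} (hz : z ≤ 0) :
    Integrable (fun x => 1 / (dispSum q x - z))
      ((volume : Measure (Fin 3 → ℝ)).restrict cube) := by
  refine integrable_inv_disp.mono' (measurable_one_div_dispSum_sub q z).aestronglyMeasurable ?_
  filter_upwards [ae_cube_disp_pos] with x hx
  exact norm_one_div_dispSum_sub_le hz hx

/-- The integral `I` as a function of a point of `ℝ³`. -/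
def cubeI (q : Fin 3 → ℝ) (z : ℝ) : ℝ := ∫ x in cube, 1 / (dispSum q x - z)

lemma intI_eq_cubeI (k : T3) (z : ℝ) : intI k z = cubeI (rep k) z := by
  rw [cubeI, ← measurePreserving_rep.map_eq, integral_map measurable_rep.aemeasurable
    (measurable_one_div_dispSum_sub _ z).aestronglyMeasurable]
  rfl

lemma integrable_one_div_w2_sub (k : T3) {z : ℝ} (hz : z ≤ 0) :
    Integrable (fun t : T3 => 1 / (w2 k t - z)) :=
  measurePreserving_rep.integrable_comp_of_integrable (integrable_one_div_dispSum_sub (rep k) hz)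

lemma ae_disp_rep_pos : ∀ᵐ t : T3, 0 < disp (rep t) :=
  measurePreserving_rep.quasiMeasurePreserving.ae ae_cube_disp_pos

lemma ae_w2_pos (k : T3) : ∀ᵐ t : T3, 0 < w2 k t := by
  filter_upwards [ae_disp_rep_pos] with t ht
  exact ht.trans_le (disp_le_dispSum _ _)

/-- The function 1/ε(x) dominates the integrand for all `q` and all z ≤ 0 at once, so dominated
convergence gives joint continuity up to and including z = 0. -/
lemma continuousOn_cubeI :
    ContinuousOn (fun p : (Fin 3 → ℝ) × ℝ => cubeI p.1 p.2) (univ ×ˢ Iic 0) := by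
  refine continuousOn_of_dominated (bound := fun x => 1 / disp x)
    (fun p _ => (measurable_one_div_dispSum_sub p.1 p.2).aestronglyMeasurable) ?_
    integrable_inv_disp ?_
  · intro p hp
    filter_upwards [ae_cube_disp_pos] with x hx
    exact norm_one_div_dispSum_sub_le hp.2 hx
  · filter_upwards [ae_cube_disp_pos] with x hx
    refine ContinuousOn.div continuousOn_const ?_ ?_
    · have h : Continuous fun p : (Fin 3 → ℝ) × ℝ => dispSum p.1 x :=
        Continuous.comp (f := fun p : (Fin 3 → ℝ) × ℝ => (p.1, x)) continuous_dispSum (by fun_prop)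
      exact (h.sub continuous_snd).continuousOn
    · intro p hp
      have h := disp_le_dispSum p.1 x
      have h2 : p.2 ≤ 0 := hp.2
      exact (by linarith : 0 < dispSum p.1 x - p.2).ne'

lemma cubeI_mono (q : Fin 3 → ℝ) {z z' : ℝ} (hzz' : z ≤ z') (hz' : z' ≤ 0) :
    cubeI q z ≤ cubeI q z' := by
  refine integral_mono_ae (integrable_one_div_dispSum_sub q (hzz'.trans hz'))
    (integrable_one_div_dispSum_sub q hz') ?_
  filter_upwards [ae_cube_disp_pos] with x hx
  have h := disp_le_dispSum q x
  exact one_div_le_one_div_of_le (by linarith) (by linarith)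

/-! ### Reflections -/

lemma measurePreserving_flip {s : Fin 3 → ℝ} (hs : ∀ i, s i = 1 ∨ s i = -1) :
    MeasurePreserving (fun (x : Fin 3 → ℝ) i => s i * x i)
      ((volume : Measure (Fin 3 → ℝ)).restrict cube)
      ((volume : Measure (Fin 3 → ℝ)).restrict cube) := by
  have h1 : ∀ i, MeasurePreserving (fun t : ℝ => s i * t)
      ((volume : Measure ℝ).restrict (Icc (-π) π)) ((volume : Measure ℝ).restrict (Icc (-π) π)) := by
    intro i
    rcases hs i with h | h
    · simp only [h, one_mul]
      exact MeasurePreserving.id _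
    · simp only [h, neg_one_mul]
      have := (Measure.measurePreserving_neg (volume : Measure ℝ)).restrict_preimage
        (measurableSet_Icc (a := -π) (b := π))
      simpa using this
  have h2 := measurePreserving_pi (fun _ : Fin 3 => (volume : Measure ℝ).restrict (Icc (-π) π))
    (fun _ : Fin 3 => (volume : Measure ℝ).restrict (Icc (-π) π)) h1
  rw [← Measure.restrict_pi_pi] at h2
  exact h2

lemma dispSum_flip {s : Fin 3 → ℝ} (hs : ∀ i, s i = 1 ∨ s i = -1) (q x : Fin 3 → ℝ) :
    dispSum (fun i => s i * q i) (fun i => s i * x i) = dispSum q x := by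
  have hcos : ∀ i t, Real.cos (s i * t) = Real.cos t := fun i t => by
    rcases hs i with h | h <;> simp [h]
  have hcos2 : ∀ i, Real.cos ((1 / 2 : ℝ) * (s i * q i + s i * x i)) =
      Real.cos ((1 / 2 : ℝ) * (q i + x i)) := fun i => by
    rw [← hcos i ((1 / 2 : ℝ) * (q i + x i))]
    congr 1
    ring
  simp only [dispSum, disp, Pi.smul_apply, Pi.add_apply, smul_eq_mul, hcos, hcos2]

/-- Changing the signs of the same coordinates in `q` and `x` preserves `dispSum`, because their
half-sum changes sign along with them, and the cube is invariant. Hence only points of [0, π]³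
matter. -/
lemma cubeI_abs (q : Fin 3 → ℝ) (z : ℝ) : cubeI (fun i => |q i|) z = cubeI q z := by
  set s : Fin 3 → ℝ := fun i => if 0 ≤ q i then 1 else -1 with hsdef
  have hs : ∀ i, s i = 1 ∨ s i = -1 := fun i => by
    by_cases h : 0 ≤ q i <;> simp [hsdef, h]
  have habs : (fun i => |q i|) = fun i => s i * q i := by
    funext i
    by_cases h : 0 ≤ q i
    · simp [hsdef, h, abs_of_nonneg h]
    · simp [hsdef, h, abs_of_neg (not_le.1 h)]
  have hmp := measurePreserving_flip hs
  rw [cubeI, habs]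
  conv_lhs => rw [← hmp.map_eq]
  rw [integral_map hmp.measurable.aemeasurable
    (measurable_one_div_dispSum_sub _ z).aestronglyMeasurable]
  simp_rw [dispSum_flip hs]
  rfl

lemma disp_abs (q : Fin 3 → ℝ) : disp (fun i => |q i|) = disp q := by
  simp only [disp, Real.cos_abs]

/-- Half-angle formulas split w₂(q, ±x) as X + A ± S, with X = w₂(0, x), A even in x and S odd.
After clearing denominators the claim becomes S² ≤ A(X + A). It follows from S² ≤ AX, that is,
Cauchy–Schwarz together with A ≥ 2∑ sin²(qᵢ/2) and X ≥ 2∑ sin²(xᵢ/2). -/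
lemma dispSum_neg_pair_le {q x : Fin 3 → ℝ} (hx : x ∈ cube) (hpos : 0 < disp x) :
    1 / dispSum q x + 1 / dispSum q (-x) ≤ 2 * (1 / dispSum 0 x) := by
  set X := dispSum 0 x with hX
  set S : ℝ := ∑ i, Real.sin (q i / 2) * Real.sin (x i / 2) with hS
  set A : ℝ := ∑ i, ((1 - Real.cos (q i)) + Real.cos (x i / 2) * (1 - Real.cos (q i / 2))) with hA
  have hplus : dispSum q x = X + A + S := by
    simp only [hX, hA, hS, dispSum, disp, ← Finset.sum_add_distrib]
    refine Finset.sum_congr rfl fun i _ => ?_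
    simp only [Pi.smul_apply, Pi.add_apply, Pi.zero_apply, smul_eq_mul, Real.cos_zero, zero_add]
    rw [show (1 / 2 : ℝ) * (q i + x i) = q i / 2 + x i / 2 by ring, Real.cos_add,
      show (1 / 2 : ℝ) * x i = x i / 2 by ring]
    ring
  have hminus : dispSum q (-x) = X + A - S := by
    simp only [hX, hA, hS, dispSum, disp, ← Finset.sum_add_distrib, ← Finset.sum_sub_distrib]
    refine Finset.sum_congr rfl fun i _ => ?_
    simp only [Pi.smul_apply, Pi.add_apply, Pi.zero_apply, smul_eq_mul, Real.cos_zero, zero_add,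
      Pi.neg_apply, Real.cos_neg]
    rw [show (1 / 2 : ℝ) * (q i + -x i) = q i / 2 - x i / 2 by ring, Real.cos_sub,
      show (1 / 2 : ℝ) * x i = x i / 2 by ring]
    ring
  have hXpos : 0 < X := hpos.trans_le (disp_le_dispSum 0 x)
  have hhalf : ∀ t : ℝ, 1 - Real.cos t = 2 * Real.sin (t / 2) ^ 2 := fun t => by
    rw [show t = 2 * (t / 2) by ring, Real.cos_two_mul, Real.sin_sq]
    ring_nf
  have hA2 : 2 * ∑ i, Real.sin (q i / 2) ^ 2 ≤ A := by
    rw [Finset.mul_sum]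
    refine Finset.sum_le_sum fun i _ => ?_
    have h1 : 0 ≤ Real.cos (x i / 2) :=
      Real.cos_nonneg_of_mem_Icc ⟨by linarith [(hx i (mem_univ i)).1],
        by linarith [(hx i (mem_univ i)).2]⟩
    have h2 := mul_nonneg h1 (sub_nonneg.2 (Real.cos_le_one (q i / 2)))
    rw [hhalf (q i)]
    linarith
  have hX2 : 2 * ∑ i, Real.sin (x i / 2) ^ 2 ≤ X := by
    refine le_trans (le_of_eq ?_) (disp_le_dispSum 0 x)
    rw [Finset.mul_sum, disp]
    exact Finset.sum_congr rfl fun i _ => (hhalf (x i)).symm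
  have hCS : S ^ 2 ≤ (∑ i, Real.sin (q i / 2) ^ 2) * ∑ i, Real.sin (x i / 2) ^ 2 :=
    Finset.sum_mul_sq_le_sq_mul_sq _ _ _
  have hs1 : 0 ≤ ∑ i, Real.sin (q i / 2) ^ 2 := Finset.sum_nonneg fun _ _ => sq_nonneg _
  have hs2 : 0 ≤ ∑ i, Real.sin (x i / 2) ^ 2 := Finset.sum_nonneg fun _ _ => sq_nonneg _
  have hA0 : 0 ≤ A := by linarith
  have hSAX : S ^ 2 ≤ A * X := by
    refine hCS.trans (mul_le_mul (by linarith) (by linarith) hs2 hA0)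
  have hlt : S ^ 2 < (X + A) ^ 2 := by nlinarith
  have habs := abs_lt_of_sq_lt_sq' hlt (by linarith)
  have hp : 0 < X + A + S := by linarith [habs.1]
  have hm : 0 < X + A - S := by linarith [habs.2]
  rw [hplus, hminus, div_add_div _ _ hp.ne' hm.ne', mul_one_div, div_le_div_iff₀ (mul_pos hp hm) hXpos]
  nlinarith

/-- The pointwise comparison can fail for single points x; it holds after averaging over x and -x,
which does not change the integral. -/
lemma cubeI_le_cubeI_zero (q : Fin 3 → ℝ) : cubeI q 0 ≤ cubeI 0 0 := by
  have hmp := measurePreserving_flip (s := fun _ => -1) (fun _ => Or.inr rfl)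
  have hint := integrable_one_div_dispSum_sub q le_rfl
  have hneg : (fun x : Fin 3 → ℝ => fun i => (-1 : ℝ) * x i) = fun x => -x := by
    funext x i
    simp
  rw [hneg] at hmp
  have h1 : cubeI q 0 = ∫ x in cube, 1 / (dispSum q (-x) - 0) := by
    rw [cubeI]
    conv_lhs => rw [← hmp.map_eq]
    rw [integral_map hmp.measurable.aemeasurable
      (measurable_one_div_dispSum_sub _ 0).aestronglyMeasurable]
  have hint' : Integrable (fun x => 1 / (dispSum q (-x) - 0))
      ((volume : Measure (Fin 3 → ℝ)).restrict cube) := hmp.integrable_comp_of_integrable hint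
  have h2 : cubeI q 0 + cubeI q 0 ≤ 2 * cubeI 0 0 := by
    conv_lhs => enter [2]; rw [h1]
    rw [cubeI, cubeI, ← integral_add hint hint', ← integral_const_mul]
    refine integral_mono_ae (hint.add hint') ((integrable_one_div_dispSum_sub 0 le_rfl).const_mul 2) ?_
    filter_upwards [ae_cube_disp_pos, ae_restrict_mem measurableSet_cube] with x hx hxc
    simp only [sub_zero]
    exact dispSum_neg_pair_le hxc hx
  linarith

lemma rep_zero : rep 0 = 0 := by
  have h := rep_coe (q := 0) fun i => ⟨by simp [Real.pi_pos], by simp [Real.pi_pos.le]⟩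
  have h0 : (fun i : Fin 3 => (((0 : Fin 3 → ℝ) i : ℝ) : AddCircle (2 * π))) = 0 := by
    funext i
    simp
  rwa [h0] at h

lemma disp_zero : disp 0 = 0 := by simp [disp]

lemma intI_le_intI_zero (k : T3) : intI k 0 ≤ intI 0 0 := by
  rw [intI_eq_cubeI, intI_eq_cubeI, rep_zero]
  exact cubeI_le_cubeI_zero _

lemma intI_nonneg (k : T3) : 0 ≤ intI k 0 :=
  integral_nonneg fun t => one_div_nonneg.2 (by simpa using w2_nonneg k t)

lemma intI_zero_pos : 0 < intI 0 0 := by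
  have h : ∫ _ : T3, (1 / 18 : ℝ) ≤ intI 0 0 := by
    refine integral_mono_ae (integrable_const _) (integrable_one_div_w2_sub 0 le_rfl) ?_
    filter_upwards [ae_w2_pos 0] with t ht
    exact one_div_le_one_div_of_le (by linarith) (by linarith [w2_le 0 t])
  refine lt_of_lt_of_le ?_ h
  rw [integral_const, smul_eq_mul]
  have : 0 < (volume : Measure T3).real univ :=
    ENNReal.toReal_pos (isOpen_univ.measure_pos volume univ_nonempty).ne' (measure_ne_top _ _)
  positivity

/-! ### Translation by half a period -/

/-- The shift by half a period of a representative, again in `(-π, π]`. -/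
def halfShift (r : ℝ) : ℝ := if 0 < r then r - π else r + π

lemma rep_add_pi (s : T3) : rep (s + fun _ => ((π : ℝ) : AddCircle (2 * π))) =
    fun i => halfShift (rep s i) := by
  have hmem : ∀ i, halfShift (rep s i) ∈ Ioc (-π) π := fun i => by
    have h := rep_mem s i
    unfold halfShift
    split_ifs with hr
    · exact ⟨by linarith, by linarith [h.2, Real.pi_pos]⟩
    · exact ⟨by linarith [h.1, Real.pi_pos], by linarith⟩
  rw [← rep_coe hmem]
  congr 1
  funext i
  have hs : ((rep s i : ℝ) : AddCircle (2 * π)) = s i := AddCircle.coe_equivIoc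
  have h2 : ((2 * π : ℝ) : AddCircle (2 * π)) = 0 := AddCircle.coe_period _
  rw [Pi.add_apply, ← hs]
  unfold halfShift
  split_ifs
  · rw [show rep s i - π = rep s i + π - 2 * π by ring, AddCircle.coe_sub, h2, sub_zero,
      AddCircle.coe_add]
  · rw [AddCircle.coe_add]

/-- In half-angles the right side minus the left is 1 + cos κ + cos(r/2)(1 ± sin(κ/2)) ± cos(κ/2)
sin(r/2), with the upper signs for r > 0 and the lower ones otherwise. Every summand is nonnegative.
-/
lemma halfShift_le {κ r : ℝ} (hκ : κ ∈ Icc (-π) π) (hr : r ∈ Ioc (-π) π) :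
    (1 - Real.cos κ) + (1 - Real.cos ((1 / 2) * (κ + halfShift r))) +
      (1 - Real.cos (halfShift r)) ≤
    6 - ((1 - Real.cos ((1 / 2) * r)) + (1 - Real.cos r)) := by
  have hcκ := Real.neg_one_le_cos κ
  have hck : 0 ≤ Real.cos (κ / 2) :=
    Real.cos_nonneg_of_mem_Icc ⟨by linarith [hκ.1], by linarith [hκ.2]⟩
  have hcr : 0 ≤ Real.cos (r / 2) :=
    Real.cos_nonneg_of_mem_Icc ⟨by linarith [hr.1], by linarith [hr.2]⟩
  have hs1 := Real.neg_one_le_sin (κ / 2)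
  have hs2 := Real.sin_le_one (κ / 2)
  rw [show (1 / 2 : ℝ) * r = r / 2 by ring]
  unfold halfShift
  split_ifs with h0
  · have hsr : 0 ≤ Real.sin (r / 2) :=
      Real.sin_nonneg_of_nonneg_of_le_pi (by linarith) (by linarith [hr.2, Real.pi_pos])
    rw [show (1 / 2 : ℝ) * (κ + (r - π)) = (κ / 2 + r / 2) - π / 2 by ring,
      Real.cos_sub_pi_div_two, Real.sin_add, Real.cos_sub_pi]
    nlinarith [mul_nonneg hck hsr, mul_nonneg hcr (by linarith : 0 ≤ 1 + Real.sin (κ / 2))]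
  · have hsr : Real.sin (r / 2) ≤ 0 :=
      Real.sin_nonpos_of_nonpos_of_neg_pi_le (by linarith) (by linarith [hr.1, Real.pi_pos])
    rw [show (1 / 2 : ℝ) * (κ + (r + π)) = (κ / 2 + r / 2) + π / 2 by ring,
      Real.cos_add_pi_div_two, Real.sin_add, Real.cos_add_pi]
    nlinarith [mul_nonneg hck (neg_nonneg.2 hsr),
      mul_nonneg hcr (by linarith : 0 ≤ 1 - Real.sin (κ / 2))]

lemma w2_add_pi_le (k s : T3) :
    w2 k (s + fun _ => ((π : ℝ) : AddCircle (2 * π))) ≤ 18 - w2 0 s := by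
  rw [w2_eq_dispSum, w2_eq_dispSum, rep_add_pi, rep_zero]
  have h := fun i => halfShift_le (rep_mem_cube k i (mem_univ i)) (rep_mem s i)
  simp only [dispSum, disp, Fin.sum_univ_three, Pi.smul_apply, Pi.add_apply, Pi.zero_apply,
    smul_eq_mul, Real.cos_zero, zero_add]
  linarith [h 0, h 1, h 2]

/-- Haar measure is invariant under translation by (π, π, π), and after it z - w₂ is at least w₂(0,
s). The integral beyond the upper edge is thereby compared with the threshold integral I(0; 0) at
the lower edge. -/
lemma neg_intI_le {z : ℝ} (hz : 18 < z) (k : T3) : -intI k z ≤ intI 0 0 := by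
  have h1 : -intI k z = ∫ s : T3,
      1 / (z - w2 k (s + fun _ => ((π : ℝ) : AddCircle (2 * π)))) := by
    rw [integral_add_right_eq_self (fun t : T3 => 1 / (z - w2 k t)), intI, ← integral_neg]
    refine integral_congr_ae (Eventually.of_forall fun t => ?_)
    dsimp only
    rw [← neg_sub (w2 k t) z, div_neg]
  rw [h1]
  refine integral_mono_of_nonneg (Eventually.of_forall fun s => ?_)
    (integrable_one_div_w2_sub 0 le_rfl) ?_
  · exact one_div_nonneg.2 (by linarith [w2_le k (s + fun _ => ((π : ℝ) : AddCircle (2 * π)))])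
  · filter_upwards [ae_w2_pos 0] with s hs
    exact one_div_le_one_div_of_le (by linarith) (by linarith [w2_add_pi_le k s])

/-! ### Zeros of a monotone family of functions -/

section ZeroSet

variable {α : Type*} [TopologicalSpace α] {R : Set α} {D : α → ℝ → ℝ}

/-- The nonpositive `z` for which `D(·, z)` vanishes somewhere on `R`. -/
def zeroSet (R : Set α) (D : α → ℝ → ℝ) : Set ℝ := {z | z ≤ 0 ∧ ∃ q ∈ R, D q z = 0}

lemma isCompact_zeroSet (hR : IsCompact R)
    (hD : ContinuousOn (fun p : α × ℝ => D p.1 p.2) (R ×ˢ Iic 0))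
    (hmono : ∀ q ∈ R, ∀ z z', z ≤ z' → z' ≤ 0 → D q z' + (z' - z) ≤ D q z) :
    IsCompact (zeroSet R D) := by
  rcases R.eq_empty_or_nonempty with rfl | hne
  · have : zeroSet (∅ : Set α) D = ∅ := by
      ext z
      simp [zeroSet]
    rw [this]
    exact isCompact_empty
  have hD0 : ContinuousOn (fun q => D q 0) R :=
    hD.comp (f := fun q => (q, (0 : ℝ))) (by fun_prop) fun q hq =>
      ⟨hq, mem_Iic.2 le_rfl⟩
  obtain ⟨q₁, hq₁, hmin⟩ := hR.exists_isMinOn hne hD0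
  -- Because `D q` decreases with slope at most -1, a zero z ≤ 0 satisfies z ≥ D q 0 ≥ m. All zeros
  -- therefore come from the compact strip over [m, 0].
  set m := D q₁ 0 with hm
  have hK : IsCompact (R ×ˢ Icc m 0) := hR.prod isCompact_Icc
  have hcont : ContinuousOn (fun p : α × ℝ => D p.1 p.2) (R ×ˢ Icc m 0) :=
    hD.mono (prod_mono_right Icc_subset_Iic_self)
  have hcl : IsCompact ((R ×ˢ Icc m 0) ∩ (fun p : α × ℝ => D p.1 p.2) ⁻¹' {0}) := by
    rw [isCompact_iff_compactSpace] at hK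
    have hc : IsClosed ((R ×ˢ Icc m 0).domRestrict (fun p : α × ℝ => D p.1 p.2) ⁻¹' {0}) :=
      isClosed_singleton.preimage hcont.domRestrict
    have h := hc.isCompact.image continuous_subtype_val
    have himg : Subtype.val '' ((R ×ˢ Icc m 0).domRestrict (fun p : α × ℝ => D p.1 p.2) ⁻¹' {0}) =
        (R ×ˢ Icc m 0) ∩ (fun p : α × ℝ => D p.1 p.2) ⁻¹' {0} := by
      ext p
      constructor
      · rintro ⟨p', hp', rfl⟩
        exact ⟨p'.2, hp'⟩
      · rintro ⟨hp, hp'⟩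
        exact ⟨⟨p, hp⟩, hp', rfl⟩
    rwa [himg] at h
  have himg : zeroSet R D =
      Prod.snd '' ((R ×ˢ Icc m 0) ∩ (fun p : α × ℝ => D p.1 p.2) ⁻¹' {0}) := by
    ext z
    constructor
    · rintro ⟨hz, q, hq, hqz⟩
      refine ⟨(q, z), ⟨⟨hq, ?_, hz⟩, hqz⟩, rfl⟩
      have h1 := hmono q hq z 0 hz le_rfl
      have h2 : m ≤ D q 0 := hmin hq
      dsimp only
      linarith
    · rintro ⟨⟨q, z'⟩, ⟨⟨hq, hz⟩, hqz⟩, rfl⟩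
      exact ⟨hz.2, q, hq, hqz⟩
  rw [himg]
  exact hcl.image continuous_snd

lemma mem_zeroSet_of_sign_change (hR : IsPreconnected R)
    (hD : ContinuousOn (fun p : α × ℝ => D p.1 p.2) (R ×ˢ Iic 0)) {z : ℝ} (hz : z ≤ 0) {q q' : α}
    (hq : q ∈ R) (hq' : q' ∈ R) (h : D q z ≤ 0) (h' : 0 ≤ D q' z) : z ∈ zeroSet R D := by
  have hDz : ContinuousOn (fun q => D q z) R :=
    hD.comp (f := fun q => (q, z)) (by fun_prop) fun q hq => ⟨hq, hz⟩
  obtain ⟨p, hp, hpz⟩ := hR.intermediate_value hq hq' hDz ⟨h, h'⟩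
  exact ⟨hz, p, hp, hpz⟩

lemma exists_neg_mem_zeroSet (hD : ContinuousOn (fun p : α × ℝ => D p.1 p.2) (R ×ˢ Iic 0))
    (hmono : ∀ q ∈ R, ∀ z z', z ≤ z' → z' ≤ 0 → D q z' + (z' - z) ≤ D q z) {q : α} (hq : q ∈ R)
    (h : D q 0 < 0) : ∃ z < 0, z ∈ zeroSet R D := by
  have hDq : ContinuousOn (fun z => D q z) (Icc (D q 0) 0) :=
    hD.comp (f := fun z => (q, z)) (by fun_prop) fun z hz => ⟨hq, hz.2⟩
  -- At z = D q 0 the slope bound already gives a nonnegative value, so the sign changes on [D q 0,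
  -- 0].
  have h1 := hmono q hq (D q 0) 0 h.le le_rfl
  obtain ⟨z, hz, hzD⟩ := intermediate_value_Icc' h.le hDq ⟨h.le, by linarith⟩
  refine ⟨z, lt_of_le_of_ne hz.2 fun h0 => ?_, hz.2, q, hq, hzD⟩
  rw [h0] at hzD
  exact h.ne hzD

/-- If `D(·, 0) < 0` on `R`, then the zero set is a compact interval left of zero. -/
lemma zeroSet_eq_Icc (hR : IsCompact R) (hRc : IsPreconnected R) (hne : R.Nonempty)
    (hD : ContinuousOn (fun p : α × ℝ => D p.1 p.2) (R ×ˢ Iic 0))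
    (hmono : ∀ q ∈ R, ∀ z z', z ≤ z' → z' ≤ 0 → D q z' + (z' - z) ≤ D q z)
    (hneg : ∀ q ∈ R, D q 0 < 0) :
    ∃ E₁ E₂, IsLeast (zeroSet R D) E₁ ∧ IsGreatest (zeroSet R D) E₂ ∧ E₂ < 0 ∧
      zeroSet R D = Icc E₁ E₂ := by
  obtain ⟨q, hq⟩ := hne
  obtain ⟨z, -, hz⟩ := exists_neg_mem_zeroSet hD hmono hq (hneg q hq)
  have hcomp := isCompact_zeroSet hR hD hmono
  obtain ⟨E₁, hE₁⟩ := hcomp.exists_isLeast ⟨z, hz⟩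
  obtain ⟨E₂, hE₂⟩ := hcomp.exists_isGreatest ⟨z, hz⟩
  have hE₂0 : E₂ < 0 := by
    obtain ⟨h0, p, hp, hp0⟩ := hE₂.1
    refine lt_of_le_of_ne h0 fun h => ?_
    rw [h] at hp0
    exact (hneg p hp).ne hp0
  refine ⟨E₁, E₂, hE₁, hE₂, hE₂0, Subset.antisymm (fun w hw => ⟨hE₁.2 hw, hE₂.2 hw⟩) ?_⟩
  rintro w ⟨hw1, hw2⟩
  obtain ⟨-, p, hp, hp0⟩ := hE₁.1
  obtain ⟨-, p', hp', hp'0⟩ := hE₂.1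
  -- Between the extreme zeros, `D · w` is nonpositive at the point belonging to E₁ and nonnegative
  -- at the point belonging to E₂; connectedness supplies a zero.
  have h1 := hmono p hp E₁ w hw1 (by linarith)
  have h2 := hmono p' hp' w E₂ hw2 hE₂0.le
  exact mem_zeroSet_of_sign_change hRc hD (by linarith) hp hp' (by linarith) (by linarith)

/-- If `D(·, 0)` changes sign on `R`, then the negative part of the zero set is an interval ending
at zero. -/
lemma zeroSet_inter_Iio_eq_Ico (hR : IsCompact R) (hRc : IsPreconnected R)
    (hD : ContinuousOn (fun p : α × ℝ => D p.1 p.2) (R ×ˢ Iic 0))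
    (hmono : ∀ q ∈ R, ∀ z z', z ≤ z' → z' ≤ 0 → D q z' + (z' - z) ≤ D q z)
    (hneg : ∃ q ∈ R, D q 0 < 0) (hnonneg : ∃ q ∈ R, 0 ≤ D q 0) :
    ∃ E₁, IsLeast (zeroSet R D) E₁ ∧ E₁ < 0 ∧ zeroSet R D ∩ Iio 0 = Ico E₁ 0 := by
  obtain ⟨q, hq, hq0⟩ := hneg
  obtain ⟨q', hq', hq'0⟩ := hnonneg
  obtain ⟨z, hz0, hz⟩ := exists_neg_mem_zeroSet hD hmono hq hq0
  obtain ⟨E₁, hE₁⟩ := (isCompact_zeroSet hR hD hmono).exists_isLeast ⟨z, hz⟩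
  refine ⟨E₁, hE₁, (hE₁.2 hz).trans_lt hz0,
    Subset.antisymm (fun w hw => ⟨hE₁.2 hw.1, hw.2⟩) ?_⟩
  rintro w ⟨hw1, hw2⟩
  obtain ⟨-, p, hp, hp0⟩ := hE₁.1
  have h1 := hmono p hp E₁ w hw1 hw2.le
  have h2 := hmono q' hq' w 0 hw2.le le_rfl
  exact ⟨mem_zeroSet_of_sign_change hRc hD hw2.le hp hq' (by linarith) (by linarith), hw2⟩

end ZeroSet

/-! ### The Fredholm determinant on an octant of the cube -/

/-- The set `[0, π]³`. -/
def octant : Set (Fin 3 → ℝ) := Set.pi univ fun _ => Icc 0 π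

/-- The Fredholm determinant as a function of a point of `ℝ³`. -/
def cubeDet (μ γ : ℝ) (q : Fin 3 → ℝ) (z : ℝ) : ℝ := disp q + γ - z - μ ^ 2 / 2 * cubeI q z

lemma fredDet_eq_cubeDet (μ γ : ℝ) (k : T3) (z : ℝ) :
    fredDet μ γ k z = cubeDet μ γ (rep k) z := by
  rw [fredDet, cubeDet, intI_eq_cubeI, w1]

lemma abs_rep_mem_octant (k : T3) : (fun i => |rep k i|) ∈ octant := fun i _ =>
  ⟨abs_nonneg _, abs_le.2 (rep_mem_cube k i (mem_univ i))⟩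

lemma fredDet_eq_cubeDet_abs (μ γ : ℝ) (k : T3) (z : ℝ) :
    fredDet μ γ k z = cubeDet μ γ (fun i => |rep k i|) z := by
  rw [fredDet_eq_cubeDet, cubeDet, cubeDet, cubeI_abs, disp_abs]

lemma exists_rep_eq_of_mem_octant {q : Fin 3 → ℝ} (hq : q ∈ octant) : ∃ k : T3, rep k = q :=
  ⟨_, rep_coe fun i => ⟨by linarith [(hq i (mem_univ i)).1, Real.pi_pos], (hq i (mem_univ i)).2⟩⟩

lemma isCompact_octant : IsCompact octant := isCompact_univ_pi fun _ => isCompact_Icc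

lemma isPreconnected_octant : IsPreconnected octant :=
  isPreconnected_univ_pi fun _ => isPreconnected_Icc

lemma octant_nonempty : octant.Nonempty := ⟨_, abs_rep_mem_octant 0⟩

lemma continuousOn_cubeDet (μ γ : ℝ) :
    ContinuousOn (fun p : (Fin 3 → ℝ) × ℝ => cubeDet μ γ p.1 p.2) (univ ×ˢ Iic 0) := by
  unfold cubeDet
  refine ContinuousOn.sub (Continuous.continuousOn ?_) (continuousOn_const.mul continuousOn_cubeI)
  exact ((continuous_disp.comp continuous_fst).add continuous_const).sub continuous_snd

lemma continuousOn_cubeDet_octant (μ γ : ℝ) :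
    ContinuousOn (fun p : (Fin 3 → ℝ) × ℝ => cubeDet μ γ p.1 p.2) (octant ×ˢ Iic 0) :=
  (continuousOn_cubeDet μ γ).mono (prod_mono_left (subset_univ _))

lemma continuous_cubeDet (μ γ : ℝ) {z : ℝ} (hz : z ≤ 0) : Continuous fun q => cubeDet μ γ q z := by
  rw [← continuousOn_univ]
  exact (continuousOn_cubeDet μ γ).comp (f := fun q => (q, z)) (by fun_prop)
    fun q _ => ⟨mem_univ _, hz⟩

lemma cubeDet_mono (μ γ : ℝ) (q : Fin 3 → ℝ) {z z' : ℝ} (hzz' : z ≤ z') (hz' : z' ≤ 0) :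
    cubeDet μ γ q z' + (z' - z) ≤ cubeDet μ γ q z := by
  have h := mul_le_mul_of_nonneg_left (cubeI_mono q hzz' hz') (show 0 ≤ μ ^ 2 / 2 by positivity)
  unfold cubeDet
  linarith

lemma mem_zeroSet_cubeDet_iff {μ γ z : ℝ} :
    z ∈ zeroSet octant (cubeDet μ γ) ↔ z ≤ 0 ∧ ∃ k, fredDet μ γ k z = 0 := by
  refine and_congr_right fun _ => ⟨?_, ?_⟩
  · rintro ⟨q, hq, h⟩
    obtain ⟨k, rfl⟩ := exists_rep_eq_of_mem_octant hq
    exact ⟨k, by rw [fredDet_eq_cubeDet, h]⟩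
  · rintro ⟨k, hk⟩
    exact ⟨_, abs_rep_mem_octant k, by rw [← fredDet_eq_cubeDet_abs, hk]⟩

lemma exists_fredDet_max (μ γ : ℝ) : ∃ k₀, ∀ k, fredDet μ γ k 0 ≤ fredDet μ γ k₀ 0 := by
  obtain ⟨q, hq, hmax⟩ := isCompact_octant.exists_isMaxOn octant_nonempty
    (continuous_cubeDet μ γ le_rfl).continuousOn
  obtain ⟨k₀, rfl⟩ := exists_rep_eq_of_mem_octant hq
  refine ⟨k₀, fun k => ?_⟩
  rw [fredDet_eq_cubeDet_abs μ γ k, fredDet_eq_cubeDet μ γ k₀]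
  exact hmax (abs_rep_mem_octant k)

/-! ### The spectra -/

/-- This inclusion covers z = 0, the converse below only z < 0. That suffices, since the extrema E₁
and E₂ needed are strictly negative and membership of 0 in Λ_μ need not be decided. -/
lemma LamNonpos_subset_zeroSet (μ γ : ℝ) : LamNonpos μ γ ⊆ zeroSet octant (cubeDet μ γ) := by
  rintro z ⟨hz, hz0⟩
  obtain ⟨k, hk⟩ := mem_iUnion.1 hz
  refine mem_zeroSet_cubeDet_iff.2 ⟨hz0, k, fredDet_eq_zero_of_hasEigenvalue ?_ hk.2.2.1⟩
  filter_upwards [ae_w2_pos k] with p hp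
  exact (by linarith : 0 < w2 k p - z).ne'

lemma mem_LamNonpos_of_mem_zeroSet {μ γ z : ℝ} (hz : z ∈ zeroSet octant (cubeDet μ γ))
    (hz0 : z < 0) : z ∈ LamNonpos μ γ := by
  obtain ⟨-, k, hk⟩ := mem_zeroSet_cubeDet_iff.1 hz
  exact ⟨mem_iUnion.2 ⟨k, mem_discreteSpectrum_friedrichs (fun h => by linarith [h.1]) hk⟩, hz0.le⟩

lemma isLeast_LamNonpos {μ γ E : ℝ} (h : IsLeast (zeroSet octant (cubeDet μ γ)) E) (hE : E < 0) :
    IsLeast (LamNonpos μ γ) E :=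
  ⟨mem_LamNonpos_of_mem_zeroSet h.1 hE, fun _ hx => h.2 (LamNonpos_subset_zeroSet μ γ hx)⟩

lemma isGreatest_LamNonpos {μ γ E : ℝ} (h : IsGreatest (zeroSet octant (cubeDet μ γ)) E)
    (hE : E < 0) : IsGreatest (LamNonpos μ γ) E :=
  ⟨mem_LamNonpos_of_mem_zeroSet h.1 hE, fun _ hx => h.2 (LamNonpos_subset_zeroSet μ γ hx)⟩

lemma mem_essentialSpectrum_opA_iff_of_neg {μ γ z : ℝ} (hz : z < 0) :
    (z : ℂ) ∈ essentialSpectrum (opA μ γ) ↔ z ∈ zeroSet octant (cubeDet μ γ) := by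
  have hz' : z ∉ Icc (0 : ℝ) 18 := fun h => by linarith [h.1]
  have hcont := continuous_cubeDet μ γ hz.le
  constructor
  · intro hess
    by_contra hno
    obtain ⟨q, hq, hmin⟩ := isCompact_octant.exists_isMinOn
      (f := fun q => |cubeDet μ γ q z|) octant_nonempty (Continuous.continuousOn (by fun_prop))
    have hne : cubeDet μ γ q z ≠ 0 := fun h => hno (And.intro hz.le ⟨q, hq, h⟩)
    have hpos : 0 < |cubeDet μ γ q z| := abs_pos.2 hne
    refine notMem_essentialSpectrum_opA hz' hpos (fun k => ?_) hess
    rw [fredDet_eq_cubeDet_abs]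
    exact hmin (abs_rep_mem_octant k)
  · intro h
    obtain ⟨-, k, hk⟩ := mem_zeroSet_cubeDet_iff.1 h
    exact mem_essentialSpectrum_opA_of_fredDet_eq_zero hz' hcont
      (fun k => fredDet_eq_cubeDet μ γ k z) hk

/-- The essential spectrum when there is nothing above `18`. -/
lemma essentialSpectrum_opA_eq {μ γ : ℝ}
    (h18 : ∀ z, 18 < z → ∀ k, fredDet μ γ k z ≤ -(z - 18)) :
    essentialSpectrum (opA μ γ) =
      Complex.ofReal '' (zeroSet octant (cubeDet μ γ) ∩ Iio 0 ∪ Icc 0 18) := by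
  ext w
  constructor
  · intro hw
    have hre : w = (w.re : ℂ) := eq_re_of_mem_essentialSpectrum (isSelfAdjoint_opA μ γ) hw
    refine ⟨w.re, ?_, hre.symm⟩
    rw [hre] at hw
    rcases lt_or_ge w.re 0 with h | h
    · exact Or.inl ⟨(mem_essentialSpectrum_opA_iff_of_neg h).1 hw, h⟩
    · refine Or.inr ⟨h, ?_⟩
      by_contra! hgt
      refine notMem_essentialSpectrum_opA (fun h' => absurd h'.2 (not_le.2 hgt)) (sub_pos.2 hgt)
        (fun k => ?_) hw
      exact le_abs.2 (Or.inr (by linarith [h18 _ hgt k]))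
  · rintro ⟨z, hz | hz, rfl⟩
    · exact (mem_essentialSpectrum_opA_iff_of_neg hz.2).2 hz.1
    · exact Icc_subset_essentialSpectrum μ γ hz

/-! ### The coupling constant `μ_r^0(γ)` -/

lemma muR_sq_div_two {γ : ℝ} (hγ : γ < 12) : muR γ ^ 2 / 2 = (12 - γ) / intI 0 0 := by
  rw [muR, div_pow, Real.sq_sqrt (by linarith), Real.sq_sqrt intI_zero_pos.le]
  ring

lemma fredDet_muR_zero {γ : ℝ} (hγ : γ < 12) : fredDet (muR γ) γ 0 0 = 2 * γ - 12 := by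
  rw [fredDet, muR_sq_div_two hγ, div_mul_cancel₀ _ intI_zero_pos.ne', w1, rep_zero, disp_zero]
  ring

/-- The term -(μ²/2) I(k; z) is at most (μ²/2) I(0; 0) = 12 - γ, and ε ≤ 6, so γ cancels and the
bound 18 - z is left. -/
lemma fredDet_muR_le_of_gt {γ z : ℝ} (hγ : γ < 12) (hz : 18 < z) (k : T3) :
    fredDet (muR γ) γ k z ≤ -(z - 18) := by
  have h := mul_le_mul_of_nonneg_left (neg_intI_le hz k)
    (div_nonneg (sub_nonneg.2 hγ.le) intI_zero_pos.le)
  rw [div_mul_cancel₀ _ intI_zero_pos.ne'] at h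
  have h2 := (abs_le.1 (abs_disp_le (rep k))).2
  rw [fredDet, muR_sq_div_two hγ, w1]
  linarith

lemma fredDet_muR_nonneg {γ : ℝ} (hγ : γ < 12) (hγ6 : 6 ≤ γ) (k : T3) :
    0 ≤ fredDet (muR γ) γ k 0 := by
  have h := mul_le_mul_of_nonneg_left (intI_le_intI_zero k)
    (div_nonneg (sub_nonneg.2 hγ.le) intI_zero_pos.le)
  rw [div_mul_cancel₀ _ intI_zero_pos.ne'] at h
  rw [fredDet, muR_sq_div_two hγ, w1]
  linarith [disp_nonneg (rep k)]

/-- For a fixed point k₀ the value Δ(k₀; 0) with this coupling is affine in γ with positive slope,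
and γ₀ is its root. -/
lemma lt_gammaZero_iff {γ : ℝ} (hγ : γ < 12) (k₀ : T3) :
    γ < gammaZero k₀ ↔ fredDet (muR γ) γ k₀ 0 < 0 := by
  have hr : 0 ≤ intI k₀ 0 / intI 0 0 := div_nonneg (intI_nonneg _) intI_zero_pos.le
  have hΔ : fredDet (muR γ) γ k₀ 0 = γ * (1 + intI k₀ 0 / intI 0 0) -
      (12 * (intI k₀ 0 / intI 0 0) - disp (rep k₀)) := by
    rw [fredDet, muR_sq_div_two hγ, w1]
    ring
  rw [gammaZero, lt_div_iff₀ (by linarith), hΔ, sub_neg]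

end FockLattice

end

/-! ### The main theorem. -/

open FockLattice

theorem theorem3p1 (γ : ℝ) (hγ : γ < 12) :
    -- the integrals `I(k; 0)` converge
    (∀ k : FockLattice.T3,
      MeasureTheory.Integrable (fun t : FockLattice.T3 => 1 / (FockLattice.w2 k t - 0))) ∧
    -- `Δ_μ(·; 0)` with `μ = μ_r^0(γ)` attains its maximum
    (∃ k₀ : FockLattice.T3, ∀ k : FockLattice.T3,
      FockLattice.fredDet (FockLattice.muR γ) γ k 0 ≤
        FockLattice.fredDet (FockLattice.muR γ) γ k₀ 0) ∧
    -- the essential spectrum, with `γ₀` built from any maximum point `k₀`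
    (∀ k₀ : FockLattice.T3,
      (∀ k : FockLattice.T3, FockLattice.fredDet (FockLattice.muR γ) γ k 0 ≤
        FockLattice.fredDet (FockLattice.muR γ) γ k₀ 0) →
      (γ < FockLattice.gammaZero k₀ →
        ∃ E₁ E₂ : ℝ, IsLeast (FockLattice.LamNonpos (FockLattice.muR γ) γ) E₁ ∧
          IsGreatest (FockLattice.LamNonpos (FockLattice.muR γ) γ) E₂ ∧
          FockLattice.essentialSpectrum (FockLattice.opA (FockLattice.muR γ) γ) =
            Complex.ofReal '' (Set.Icc E₁ E₂ ∪ Set.Icc 0 18)) ∧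
      (FockLattice.gammaZero k₀ ≤ γ → γ < 6 →
        ∃ E₁ : ℝ, IsLeast (FockLattice.LamNonpos (FockLattice.muR γ) γ) E₁ ∧
          FockLattice.essentialSpectrum (FockLattice.opA (FockLattice.muR γ) γ) =
            Complex.ofReal '' Set.Icc E₁ 18) ∧
      (6 ≤ γ →
        FockLattice.essentialSpectrum (FockLattice.opA (FockLattice.muR γ) γ) =
          Complex.ofReal '' Set.Icc 0 18)) := by
  have hcont := continuousOn_cubeDet_octant (muR γ) γ
  have hmono : ∀ q ∈ octant, ∀ z z', z ≤ z' → z' ≤ 0 →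
      cubeDet (muR γ) γ q z' + (z' - z) ≤ cubeDet (muR γ) γ q z :=
    fun q _ z z' h h' => cubeDet_mono (muR γ) γ q h h'
  have hess := essentialSpectrum_opA_eq (μ := muR γ) (γ := γ)
    fun z hz k => fredDet_muR_le_of_gt hγ hz k
  refine ⟨fun k => integrable_one_div_w2_sub k le_rfl, exists_fredDet_max _ _,
    fun k₀ hk₀ => ⟨fun h => ?_, fun h h6 => ?_, fun h6 => ?_⟩⟩
  · rw [lt_gammaZero_iff hγ] at h
    obtain ⟨E₁, E₂, h1, h2, h0, hZ⟩ := zeroSet_eq_Icc isCompact_octant isPreconnected_octant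
      octant_nonempty hcont hmono fun q hq => by
        obtain ⟨k, rfl⟩ := exists_rep_eq_of_mem_octant hq
        rw [← fredDet_eq_cubeDet]
        exact (hk₀ k).trans_lt h
    refine ⟨E₁, E₂, isLeast_LamNonpos h1 ((h1.2 h2.1).trans_lt h0), isGreatest_LamNonpos h2 h0, ?_⟩
    rw [hess, hZ, inter_eq_left.2 fun x hx => hx.2.trans_lt h0]
  · rw [← not_lt, lt_gammaZero_iff hγ, not_lt] at h
    -- The origin supplies the negative value 2γ - 12 and the maximum point a nonnegative one.
    obtain ⟨E₁, h1, h0, hZ⟩ := zeroSet_inter_Iio_eq_Ico isCompact_octant isPreconnected_octant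
      hcont hmono
      ⟨_, abs_rep_mem_octant 0, by rw [← fredDet_eq_cubeDet_abs, fredDet_muR_zero hγ]; linarith⟩
      ⟨_, abs_rep_mem_octant k₀, by rwa [← fredDet_eq_cubeDet_abs]⟩
    refine ⟨E₁, isLeast_LamNonpos h1 h0, ?_⟩
    rw [hess, hZ, Ico_union_Icc_eq_Icc h0.le (by norm_num)]
  · have hZ : zeroSet octant (cubeDet (muR γ) γ) ∩ Iio 0 = ∅ := by
      refine eq_empty_iff_forall_notMem.2 fun z hz => ?_
      obtain ⟨hz0, k, hk⟩ := mem_zeroSet_cubeDet_iff.1 hz.1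
      -- A negative zero z at k would force Δ(k; 0) ≤ z < 0, against nonnegativity for γ ≥ 6.
      have h1 := cubeDet_mono (muR γ) γ (rep k) hz0 le_rfl
      rw [← fredDet_eq_cubeDet, ← fredDet_eq_cubeDet, hk] at h1
      have h2 : z < 0 := hz.2
      linarith [fredDet_muR_nonneg hγ h6 k]
    rw [hess, hZ, empty_union]
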